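/- Let $K$ be a field and let $M\subseteq\mathbb{Z}^2$ be a submodule of rank $2$. Its lattice ideal is $I_M=(\mathbf{x}^{a^+}-\mathbf{x}^{a^-} : a\in M)\subseteq K[x,y]$, where $a=a^+-a^-$ is the decomposition of $a$ into its componentwise positive and negative parts. An order ideal is a subset $\mathcal{O}\subseteq\mathbb{N}^2$ closed under passing to componentwise smaller vectors. It is compatible (mod $M$) if elements of $\mathcal{O}$ that are congruent mod $M$ are equal, and maximal compatible if it is inclusion-maximal among compatible order ideals. Its corners are the minimal elements of $\mathbb{N}^2\setminus\mathcal{O}$; its border is the set of $u\in\mathbb{N}^2\setminus\mathcal{O}$ such that $u-e_i\in\mathcal{O}$ for some unit vector $e_i$. If the residue classes of the monomials with exponents in $\mathcal{O}$ form a $K$-basis of $K[x,y]/I_M$, the $\mathcal{O}$-border basis of $I_M$ consists, for each border element $b$, of the element of $I_M$ of the form $\mathbf{x}^b-f_b$ with $f_b$ a linear combination of monomials with exponents in $\mathcal{O}$. For a term order $\sigma$, let $\mathcal{O}_\sigma$ be the set of exponents that are not leading exponents of nonzero elements of $I_M$. 1. An order ideal is maximal compatible if and only if it equals $\mathcal{O}_\sigma$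 for some term order $\sigma$. The reduced $\sigma$-Gröbner basis of $I_M$ is $\{\mathbf{x}^{c}-\mathbf{x}^{\bar c} : c \text{ a corner of } \mathcal{O}_\sigma\}$, where $\bar c$ is the representative of $c$ mod $M$ in $\mathcal{O}_\sigma$. In this way maximal compatible order ideals and reduced Gröbner bases of $I_M$ correspond bijectively. 2. Every border basis of $I_M$ comes from a reduced Gröbner basis: its order ideal is $\mathcal{O}_\sigma$ for some term order $\sigma$, and its elements belonging to the corners of $\mathcal{O}_\sigma$ form the reduced $\sigma$-Gröbner basis. Conversely, for every term order $\sigma$, the reduced $\sigma$-Gröbner basis of $I_M$ consists of the elements of an $\mathcal{O}_\sigma$-border basis of $I_M$ that belong to the corners of $\mathcal{O}_\sigma$. 3. There are integers with $M=\langle(a_1,a_2),(0,a_3)\rangle$, $a_1>0$, $0\le a_2<a_3$, and integers with $M=\langle(b_1,b_2),(b_3,0)\rangle$, $b_2>0$, $0\le b_1<b_3$ (the Hermite normal forms of $M$ for the two orders of the columns). For these, the rectangles $\{(p,q): 0\le p<a_1,\ 0\le q<a_3\}$ and $\{(p,q): 0\le p<b_3,\ 0\le q<b_2\}$ are maximal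 compatible order ideals, and the corresponding reduced Gröbner bases are $$\{x^{a_1}-y^{c},\ y^{a_3}-1\}\quad\text{and}\quad\{y^{b_2}-x^{d},\ x^{b_3}-1\},$$ where $c=a_3-a_2$ if $a_2>0$ and $c=0$ if $a_2=0$, and $d=b_3-b_1$ if $b_1>0$ and $d=0$ if $b_1=0$. These are exactly the reduced Gröbner bases of $I_M$ with two elements; they coincide if and only if $a_2=0$. 4. Every other reduced Gröbner basis of $I_M$ (say with respect to $\sigma$) has exactly three elements, $x^{\alpha}-y^{\alpha'}$, $y^{\beta}-x^{\beta'}$ and $x^{\gamma_1}y^{\gamma_2}-1$, where $A=(\alpha,0)$, $B=(0,\beta)$, $C=(\gamma_1,\gamma_2)$ are the corners of the maximal compatible order ideal $\mathcal{O}_\sigma$ and $A'=(0,\alpha')$, $B'=(\beta',0)$ are the representatives of $A$, $B$ mod $M$ in $\mathcal{O}_\sigma$. -/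

import Mathlib

open MvPolynomial

namespace LatticeBorder

noncomputable section

variable {n : ℕ} {K : Type*} [Field K]

/-- An exponent vector regarded as a vector of integers. -/
def toInt (u : Fin n →₀ ℕ) : Fin n → ℤ := fun i => (u i : ℤ)

/-- The positive part `a⁺` of an integer vector; the negative part is `posPart (-a)`. -/
def posPart (a : Fin n → ℤ) : Fin n →₀ ℕ :=
  Finsupp.equivFunOnFinite.symm fun i => (a i).toNat

/-- The monomial with exponent `u`. -/
def mono (K : Type*) [Field K] (u : Fin n →₀ ℕ) : MvPolynomial (Fin n) K := monomial u 1

/-- The lattice ideal of `M`, generated by the binomials `x^(a⁺) - x^(a⁻)` with `a ∈ M`. -/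
def latticeIdeal (K : Type*) [Field K] (M : Submodule ℤ (Fin n → ℤ)) :
    Ideal (MvPolynomial (Fin n) K) :=
  Ideal.span {f | ∃ a ∈ M, f = mono K (posPart a) - mono K (posPart (-a))}

/-- Congruence modulo `M`. -/
def Equivalent (M : Submodule ℤ (Fin n → ℤ)) (u v : Fin n →₀ ℕ) : Prop :=
  toInt u - toInt v ∈ M

/-- A compatible order ideal: a set of exponents closed under divisors (a lower set for the
componentwise order) in which congruent elements are equal. -/
def IsCompatible (M : Submodule ℤ (Fin n → ℤ)) (O : Set (Fin n →₀ ℕ)) : Prop :=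
  IsLowerSet O ∧ ∀ u ∈ O, ∀ v ∈ O, Equivalent M u v → u = v

/-- A compatible order ideal which is maximal for inclusion. -/
def IsMaximalCompatible (M : Submodule ℤ (Fin n → ℤ)) (O : Set (Fin n →₀ ℕ)) : Prop :=
  Maximal (IsCompatible M) O

/-- The border of a set of exponents. -/
def border (O : Set (Fin n →₀ ℕ)) : Set (Fin n →₀ ℕ) :=
  {u | u ∉ O ∧ ∃ v ∈ O, ∃ i : Fin n, u = v + Finsupp.single i 1}

/-- The corners of `O`: the minimal elements of its complement, i.e. the minimal generators of the
monomial ideal complementary to `O`. -/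
def corners (O : Set (Fin n →₀ ℕ)) : Set (Fin n →₀ ℕ) :=
  {u | Minimal (fun v => v ∉ O) u}

/-- `B` is the `O`-border basis of the ideal `I`: `O` is an order ideal, the residue classes of its
monomials form a `K`-basis of the quotient by `I`, and `B` consists of one element `g b` of `I` for
each border exponent `b`, of the form `x^b - (a linear combination of monomials of O)`. -/
structure IsBorderBasis (I : Ideal (MvPolynomial (Fin n) K)) (O : Set (Fin n →₀ ℕ))
    (B : Set (MvPolynomial (Fin n) K)) : Prop where
  isLowerSet : IsLowerSet O
  linearIndependent : LinearIndependent K fun u : O => Ideal.Quotient.mk I (mono K u.1)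
  span_eq_top : Submodule.span K (Set.range fun u : O => Ideal.Quotient.mk I (mono K u.1)) = ⊤
  eq_image : ∃ g : (Fin n →₀ ℕ) → MvPolynomial (Fin n) K,
    (∀ b ∈ border O, g b ∈ I ∧ ((mono K b - g b).support : Set (Fin n →₀ ℕ)) ⊆ O) ∧
      B = g '' border O

/-- The elements of an `O`-border basis `B` that belong to the corners of `O`. -/
def cornerPart (O : Set (Fin n →₀ ℕ)) (B : Set (MvPolynomial (Fin n) K)) :
    Set (MvPolynomial (Fin n) K) :=
  {g ∈ B | ∃ c ∈ corners O, c ∈ g.support}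

/-- The exponents that are not leading exponents of nonzero elements of `I`. -/
def standardExponents (m : MonomialOrder (Fin n)) (I : Ideal (MvPolynomial (Fin n) K)) :
    Set (Fin n →₀ ℕ) :=
  {u | ∀ f ∈ I, f ≠ 0 → m.degree f ≠ u}

/-- `G` is the reduced Gröbner basis of `I` with respect to the term order `m`. -/
structure IsReducedGroebnerBasis (m : MonomialOrder (Fin n))
    (I : Ideal (MvPolynomial (Fin n) K)) (G : Set (MvPolynomial (Fin n) K)) : Prop where
  finite : G.Finite
  subset : G ⊆ I
  span_leadingTerm : Ideal.span (m.leadingTerm '' G) =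
    Ideal.span (m.leadingTerm '' (I : Set (MvPolynomial (Fin n) K)))
  monic : ∀ g ∈ G, m.Monic g
  reduced : ∀ g ∈ G, ∀ g' ∈ G, g ≠ g' → ∀ u ∈ g.support, ¬ m.degree g' ≤ u

/-- The binomials `x^c - x^r`, for `c` a corner of `O` and `r` a representative of `c` in `O`. -/
def cornerBinomials (K : Type*) [Field K] (M : Submodule ℤ (Fin n → ℤ))
    (O : Set (Fin n →₀ ℕ)) : Set (MvPolynomial (Fin n) K) :=
  {f | ∃ c ∈ corners O, ∃ r ∈ O, Equivalent M c r ∧ f = mono K c - mono K r}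

/-- The point `(p, q)` of `ℕ²`. -/
def pt (p q : ℕ) : Fin 2 →₀ ℕ := Finsupp.equivFunOnFinite.symm ![p, q]

/-- The rectangle of all `(p, q)` with `p < a` and `q < b`. -/
def rect (a b : ℕ) : Set (Fin 2 →₀ ℕ) := {u | u 0 < a ∧ u 1 < b}

/-- `M` is generated by the rows `(a₁, a₂)`, `(0, a₃)` of a matrix in Hermite normal form. -/
def IsHNF (M : Submodule ℤ (Fin 2 → ℤ)) (a₁ a₂ a₃ : ℕ) : Prop :=
  0 < a₁ ∧ a₂ < a₃ ∧ M = Submodule.span ℤ {![(a₁ : ℤ), (a₂ : ℤ)], ![0, (a₃ : ℤ)]}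

/-- `M` is generated by the rows `(b₁, b₂)`, `(b₃, 0)` of a matrix in Hermite normal form with
respect to the second and then the first column. -/
def IsReverseHNF (M : Submodule ℤ (Fin 2 → ℤ)) (b₁ b₂ b₃ : ℕ) : Prop :=
  0 < b₂ ∧ b₁ < b₃ ∧ M = Submodule.span ℤ {![(b₁ : ℤ), (b₂ : ℤ)], ![(b₃ : ℤ), 0]}

/-- The binomials `x^a₁ - y^c`, `y^a₃ - 1`, where `c` is `a₃ - a₂` if `a₂ > 0` and `0` if
`a₂ = 0`. -/
def rectBasis (K : Type*) [Field K] (a₁ a₂ a₃ : ℕ) : Set (MvPolynomial (Fin 2) K) :=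
  {X 0 ^ a₁ - X 1 ^ ((a₃ - a₂) % a₃), X 1 ^ a₃ - 1}

/-- The binomials `y^b₂ - x^d`, `x^b₃ - 1`, where `d` is `b₃ - b₁` if `b₁ > 0` and `0` if
`b₁ = 0`. -/
def reverseRectBasis (K : Type*) [Field K] (b₁ b₂ b₃ : ℕ) : Set (MvPolynomial (Fin 2) K) :=
  {X 1 ^ b₂ - X 0 ^ ((b₃ - b₁) % b₃), X 0 ^ b₃ - 1}

end

end LatticeBorder

/-! An element of the lattice ideal has coefficient sum zero over every congruence class mod `M`
(`classSum_eq_zero`), and differences of congruent monomials lie in the ideal (`mono_sub_mono_mem`).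
Hence the standard exponents of a term order are the smallest elements of the classes
(`mem_standardExponents_iff`): a lower set meeting each class exactly once, so a maximal compatible
one. The same two facts force the elements of a reduced Gröbner basis, and of any border basis, to
be binomials (`eq_mono_sub_mono`). None of this needs the plane.

The plane is used to find a term order for a given maximal compatible `O`. A corner and its
representative have disjoint supports (`corner_disjoint`). Full rank puts a corner on each axis, and
so (α,0) ≡ (0,α'), (0,β) ≡ (β',0), while every other corner is congruent to 0 (`IsFrame`). As α' < β
and β' < α, the weight (α'+β, α+β') makes each corner heavier than its representative, so the
standard exponents of a term order refining this weight lie in `O`; maximality gives equality.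

Two corners off the axes would, after cancelling their common part, give congruent points of `O` on
different axes, so there is at most one. If there is none, `O` is a rectangle, and adding the two
axis congruences forces α' = 0 or β' = 0. A maximal compatible rectangle with a side vector in `M`
along a given axis is unique, hence it is one of the two Hermite rectangles. -/

namespace LatticeBorder

/-! ### Congruence classes, standard exponents and corners -/

section General

variable {n : ℕ} {K : Type*} [Field K] {M : Submodule ℤ (Fin n → ℤ)}

lemma toInt_add (u v : Fin n →₀ ℕ) : toInt (u + v) = toInt u + toInt v := by
  ext i; simp [toInt]

lemma toInt_posPart_sub (a : Fin n → ℤ) : toInt (posPart a) - toInt (posPart (-a)) = a := by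
  ext i
  simp only [toInt, posPart, Pi.sub_apply, Finsupp.equivFunOnFinite_symm_apply_apply, Pi.neg_apply]
  omega

lemma Equivalent.refl (u : Fin n →₀ ℕ) : Equivalent M u u := by simp [Equivalent]

lemma Equivalent.symm {u v : Fin n →₀ ℕ} (h : Equivalent M u v) : Equivalent M v u := by
  simpa [Equivalent] using M.neg_mem h

lemma Equivalent.trans {u v w : Fin n →₀ ℕ} (h : Equivalent M u v) (h' : Equivalent M v w) :
    Equivalent M u w := by
  simpa [Equivalent] using M.add_mem h h'

lemma equivalent_add_right_iff {u v w : Fin n →₀ ℕ} :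
    Equivalent M (u + w) (v + w) ↔ Equivalent M u v := by
  simp [Equivalent, toInt_add]

lemma equivalent_add_left_iff {u v w : Fin n →₀ ℕ} :
    Equivalent M (w + u) (w + v) ↔ Equivalent M u v := by
  simp [Equivalent, toInt_add]

/-- The sum of the coefficients of a polynomial over the exponents congruent to `w`. -/
noncomputable def classSum (K : Type*) [Field K] (M : Submodule ℤ (Fin n → ℤ)) (w : Fin n →₀ ℕ) :
    MvPolynomial (Fin n) K →ₗ[K] K :=
  open Classical in
  (basisMonomials (Fin n) K).constr K fun u => if Equivalent M u w then 1 else 0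

open Classical in
lemma classSum_monomial (w u : Fin n →₀ ℕ) (c : K) :
    classSum K M w (monomial u c) = if Equivalent M u w then c else 0 := by
  have h : classSum K M w (monomial u 1) = if Equivalent M u w then 1 else 0 := by
    rw [← congrFun (coe_basisMonomials (Fin n) K) u]
    exact (basisMonomials (Fin n) K).constr_basis K _ u
  have hc : monomial u c = c • monomial u (1 : K) := by simp [smul_monomial]
  rw [hc, map_smul, h]
  split_ifs <;> simp

/-- A monomial multiple of a generator is a difference of two congruent monomials, whose
contributions to any class sum cancel. -/
lemma classSum_eq_zero {f : MvPolynomial (Fin n) K} (hf : f ∈ latticeIdeal K M)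
    (w : Fin n →₀ ℕ) : classSum K M w f = 0 := by
  classical
  -- The class sum is only `K`-linear; quantifying over all multiples lets the span induction pass
  -- through multiplication by polynomials.
  suffices h : ∀ p, classSum K M w (p * f) = 0 by simpa using h 1
  induction hf using Submodule.span_induction with
  | mem x hx =>
    obtain ⟨a, ha, rfl⟩ := hx
    intro p
    induction p using MvPolynomial.induction_on' with
    | monomial u c =>
      have hu : Equivalent M (u + posPart a) (u + posPart (-a)) := by
        rw [equivalent_add_left_iff, Equivalent, toInt_posPart_sub]
        exact ha
      have hiff : Equivalent M (u + posPart a) w ↔ Equivalent M (u + posPart (-a)) w :=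
        ⟨hu.symm.trans, hu.trans⟩
      simp only [mono, mul_sub, monomial_mul, map_sub, classSum_monomial, hiff, sub_self]
    | add p q hp hq => rw [add_mul, map_add, hp, hq, add_zero]
  | zero => simp
  | add x y _ _ hx hy => intro p; rw [mul_add, map_add, hx, hy, add_zero]
  | smul a x _ hx => intro p; rw [smul_eq_mul, ← mul_assoc]; exact hx _

lemma classSum_eq_coeff {f : MvPolynomial (Fin n) K} {u : Fin n →₀ ℕ}
    (h : ∀ v ∈ f.support, Equivalent M v u → v = u) : classSum K M u f = f.coeff u := by
  classical
  conv_lhs => rw [f.as_sum]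
  rw [map_sum, Finset.sum_eq_single u]
  · rw [classSum_monomial, if_pos (Equivalent.refl u)]
  · intro v hv hne
    rw [classSum_monomial, if_neg fun he => hne (h v hv he)]
  · intro hu
    rw [notMem_support_iff.1 hu]
    simp

/-- If `u` were alone in its class, the class sum would be its nonzero coefficient. -/
lemma exists_equivalent_mem_support {f : MvPolynomial (Fin n) K} (hf : f ∈ latticeIdeal K M)
    {u : Fin n →₀ ℕ} (hu : u ∈ f.support) : ∃ v ∈ f.support, Equivalent M v u ∧ v ≠ u := by
  by_contra! h
  have := classSum_eq_coeff h
  rw [classSum_eq_zero hf] at this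
  exact mem_support_iff.1 hu this.symm

lemma eq_zero_of_support_subset {f : MvPolynomial (Fin n) K} (hf : f ∈ latticeIdeal K M)
    {O : Set (Fin n →₀ ℕ)} (hO : IsCompatible M O) (hs : (f.support : Set (Fin n →₀ ℕ)) ⊆ O) :
    f = 0 := by
  by_contra h0
  obtain ⟨u, hu⟩ := support_nonempty.2 h0
  obtain ⟨v, hv, he, hne⟩ := exists_equivalent_mem_support hf hu
  exact hne (hO.2 v (hs hv) u (hs hu) he)

lemma mono_sub_mono_mem {u v : Fin n →₀ ℕ} (h : Equivalent M u v) :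
    mono K u - mono K v ∈ latticeIdeal K M := by
  set a := toInt u - toInt v with ha
  -- Dividing out the gcd `u ⊓ v` of the two monomials leaves a generator of the ideal.
  have h1 : u = (u ⊓ v) + posPart a := by
    ext i; simp [ha, posPart, toInt]; omega
  have h2 : v = (u ⊓ v) + posPart (-a) := by
    ext i; simp [ha, posPart, toInt]; omega
  have h3 : mono K u - mono K v =
      mono K (u ⊓ v) * (mono K (posPart a) - mono K (posPart (-a))) := by
    simp only [mono, mul_sub, monomial_mul, one_mul, ← h1, ← h2]
  rw [h3]
  exact Ideal.mul_mem_left _ _ (Ideal.subset_span ⟨a, h, rfl⟩)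

open Classical in
lemma coeff_mono_sub_mono (u v w : Fin n →₀ ℕ) :
    (mono K u - mono K v).coeff w = (if u = w then 1 else 0) - if v = w then 1 else 0 := by
  simp [mono, coeff_monomial]

lemma support_mono_sub_mono {u v : Fin n →₀ ℕ} (h : u ≠ v) :
    (mono K u - mono K v).support = {u, v} := by
  classical
  ext w
  rw [mem_support_iff, coeff_mono_sub_mono]
  by_cases h1 : u = w
  · subst h1; simp [h.symm]
  · by_cases h2 : v = w
    · subst h2; simp [h]
    · simp [h1, h2, eq_comm (a := w)]

section MonomialOrder

variable {m : MonomialOrder (Fin n)}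

lemma degree_mono_sub_mono {u v : Fin n →₀ ℕ} (h : m.toSyn v < m.toSyn u) :
    m.degree (mono K u - mono K v) = u := by
  have hne : u ≠ v := by rintro rfl; exact lt_irrefl _ h
  have hu : u ∈ (mono K u - mono K v).support := by simp [support_mono_sub_mono hne]
  have h0 : mono K u - mono K v ≠ 0 := support_nonempty.1 ⟨u, hu⟩
  have hd := m.degree_mem_support h0
  rw [support_mono_sub_mono hne] at hd
  simp only [Finset.mem_insert, Finset.mem_singleton] at hd
  rcases hd with hd | hd
  · exact hd
  · have := m.le_degree hu
    rw [hd] at this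
    exact absurd this (not_le.2 h)

lemma monic_mono_sub_mono {u v : Fin n →₀ ℕ} (h : m.toSyn v < m.toSyn u) :
    m.Monic (mono K u - mono K v) := by
  classical
  have hne : v ≠ u := by rintro rfl; exact lt_irrefl _ h
  rw [MonomialOrder.Monic, MonomialOrder.leadingCoeff, degree_mono_sub_mono h,
    coeff_mono_sub_mono]
  simp [hne]

/-- A smaller congruent exponent yields a binomial with leading exponent `u`; conversely, a leading
exponent has a congruent companion in the support, which is smaller. -/
lemma mem_standardExponents_iff {u : Fin n →₀ ℕ} :
    u ∈ standardExponents m (latticeIdeal K M) ↔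
      ∀ v, Equivalent M u v → m.toSyn u ≤ m.toSyn v := by
  constructor
  · intro hu v hv
    by_contra! hlt
    have hne : u ≠ v := by rintro rfl; exact lt_irrefl _ hlt
    refine hu _ (mono_sub_mono_mem (K := K) hv) ?_ (degree_mono_sub_mono hlt)
    exact support_nonempty.1 ⟨u, by simp [support_mono_sub_mono hne]⟩
  · rintro hu f hf h0 rfl
    obtain ⟨v, hv, he, hne⟩ := exists_equivalent_mem_support hf (m.degree_mem_support h0)
    exact hne (m.toSyn.injective (le_antisymm (m.le_degree hv) (hu v he.symm)))

lemma notMem_standardExponents_iff {I : Ideal (MvPolynomial (Fin n) K)} {u : Fin n →₀ ℕ} :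
    u ∉ standardExponents m I ↔ ∃ f ∈ I, f ≠ 0 ∧ m.degree f = u := by
  simp [standardExponents]

lemma isCompatible_standardExponents :
    IsCompatible M (standardExponents m (latticeIdeal K M)) := by
  constructor
  · intro u v hvu hu
    rw [mem_standardExponents_iff] at hu ⊢
    intro w hw
    obtain ⟨t, rfl⟩ := exists_add_of_le hvu
    have := hu (w + t) (equivalent_add_right_iff.2 hw)
    rw [map_add, map_add] at this
    exact le_of_add_le_add_right this
  · intro u hu v hv h
    rw [mem_standardExponents_iff] at hu hv
    exact m.toSyn.injective (le_antisymm (hu v h) (hv u h.symm))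

lemma exists_mem_standardExponents (u : Fin n →₀ ℕ) :
    ∃ r ∈ standardExponents m (latticeIdeal K M), Equivalent M u r := by
  obtain ⟨r, hr, hmin⟩ := (InvImage.wf m.toSyn (wellFounded_lt (α := m.syn))).has_min
    {r | Equivalent M u r} ⟨u, Equivalent.refl u⟩
  exact ⟨r, mem_standardExponents_iff.2 fun v hv => not_lt.1 (hmin v (hr.trans hv)), hr⟩

end MonomialOrder

variable {O : Set (Fin n →₀ ℕ)}

/-- A set meeting every class cannot grow: a new element would be congruent to its old
representative. -/
lemma IsCompatible.isMaximalCompatible (hO : IsCompatible M O)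
    (hc : ∀ u, ∃ r ∈ O, Equivalent M u r) : IsMaximalCompatible M O := by
  refine ⟨hO, fun O' hO' hle u hu => ?_⟩
  obtain ⟨r, hr, h⟩ := hc u
  rwa [hO'.2 u hu r (hle hr) h]

lemma isMaximalCompatible_standardExponents (m : MonomialOrder (Fin n)) :
    IsMaximalCompatible M (standardExponents m (latticeIdeal K M)) :=
  isCompatible_standardExponents.isMaximalCompatible exists_mem_standardExponents

lemma exists_corner_le {u : Fin n →₀ ℕ} (hu : u ∉ O) : ∃ c ∈ corners O, c ≤ u := by
  obtain ⟨c, hc, h⟩ := exists_minimal_le_of_wellFoundedLT (fun v => v ∉ O) u hu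
  exact ⟨c, h, hc⟩

/-- Dickson's lemma: the corners form an antichain. -/
lemma finite_corners : (corners O).Finite :=
  WellQuasiOrderedLE.finite_of_isAntichain fun _ ha _ hb hne hle =>
    hne (le_antisymm hle (hb.2 ha.1 hle))

lemma corner_eq_of_le {c c' : Fin n →₀ ℕ} (hc : c ∈ corners O) (hc' : c' ∈ corners O)
    (h : c' ≤ c) : c' = c :=
  le_antisymm h (hc.2 hc'.1 h)

lemma IsMaximalCompatible.zero_mem (hO : IsMaximalCompatible M O) : 0 ∈ O := by
  by_contra h0
  have hemp : O = ∅ := by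
    ext u
    simp only [Set.mem_empty_iff_false, iff_false]
    exact fun hu => h0 (hO.1.1 (by simp) hu)
  have hc : IsCompatible M ({0} : Set (Fin n →₀ ℕ)) := by
    refine ⟨fun u v hvu hu => ?_, fun u hu v hv _ => by rw [hu, hv]⟩
    rw [Set.mem_singleton_iff] at hu ⊢
    exact le_antisymm (hu ▸ hvu) (by simp)
  exact h0 (hO.2 hc (by simp [hemp]) rfl)

/-- In a maximal compatible order ideal every corner has a representative. -/
lemma IsMaximalCompatible.exists_rep_corner (hO : IsMaximalCompatible M O) {c : Fin n →₀ ℕ}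
    (hc : c ∈ corners O) : ∃ r ∈ O, Equivalent M c r := by
  by_contra! h
  have hcomp : IsCompatible M (insert c O) := by
    constructor
    · rintro u v hvu (rfl | hu)
      · by_contra hv
        rw [Set.mem_insert_iff, not_or] at hv
        exact hv.1 (le_antisymm hvu (hc.2 hv.2 hvu))
      · exact Or.inr (hO.1.1 hvu hu)
    · rintro u (rfl | hu) v (rfl | hv) he
      · rfl
      · exact absurd he (h v hv)
      · exact absurd he.symm (h u hu)
      · exact hO.1.2 u hu v hv he
  exact hc.1 (hO.2 hcomp (Set.subset_insert c O) (Set.mem_insert c O))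

lemma IsMaximalCompatible.eq_of_subset {O' : Set (Fin n →₀ ℕ)} (hO : IsMaximalCompatible M O)
    (hO' : IsMaximalCompatible M O') (h : O ⊆ O') : O = O' :=
  Set.Subset.antisymm h (hO.2 hO'.1 h)

lemma mono_sub_mono_inj {c r c' r' : Fin n →₀ ℕ} (hc : c ∉ O) (hr' : r' ∈ O) (hr : r ∈ O)
    (hc' : c' ∉ O) (h : mono K c - mono K r = mono K c' - mono K r') : c = c' := by
  have hne : c ≠ r := fun h => hc (h ▸ hr)
  have hne' : c' ≠ r' := fun h => hc' (h ▸ hr')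
  have : c ∈ (mono K c' - mono K r').support := by rw [← h]; simp [support_mono_sub_mono hne]
  simp only [support_mono_sub_mono hne', Finset.mem_insert, Finset.mem_singleton] at this
  rcases this with h | rfl
  · exact h
  · exact absurd hr' hc

/-- An element of the lattice ideal of the form `x^b - (a combination of monomials of O)` is
the binomial `x^b - x^r`. -/
lemma eq_mono_sub_mono {g : MvPolynomial (Fin n) K} (hO : IsCompatible M O)
    (hg : g ∈ latticeIdeal K M) {b r : Fin n →₀ ℕ} (hr : r ∈ O) (h : Equivalent M b r)
    (hs : ((mono K b - g).support : Set (Fin n →₀ ℕ)) ⊆ O) : g = mono K b - mono K r := by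
  classical
  have h1 : mono K b - mono K r - g ∈ latticeIdeal K M :=
    Ideal.sub_mem _ (mono_sub_mono_mem h) hg
  have h2 : mono K b - mono K r - g = 0 := by
    refine eq_zero_of_support_subset h1 hO fun v hv => ?_
    have h3 : mono K b - mono K r - g = (mono K b - g) - mono K r := by ring
    rw [h3] at hv
    rcases Finset.mem_union.1 (support_sub _ _ _ hv) with hv | hv
    · exact hs hv
    · have := support_monomial_subset hv
      rw [Finset.mem_singleton] at this
      rwa [this]
  exact (sub_eq_zero.1 h2).symm

end General

/-! ### Reduced Gröbner bases and border bases -/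

section General

variable {n : ℕ} {K : Type*} [Field K] {M : Submodule ℤ (Fin n → ℤ)}

section MonomialOrder

variable {m : MonomialOrder (Fin n)}

/-- For monic elements the leading terms are monomials, and membership in a monomial ideal is
divisibility of exponents. -/
lemma span_leadingTerm_eq_iff {I : Ideal (MvPolynomial (Fin n) K)}
    {G : Set (MvPolynomial (Fin n) K)} (hG : G ⊆ I) (hm : ∀ g ∈ G, m.Monic g) :
    Ideal.span (m.leadingTerm '' G) =
        Ideal.span (m.leadingTerm '' (I : Set (MvPolynomial (Fin n) K))) ↔
      ∀ u ∉ standardExponents m I, ∃ g ∈ G, m.degree g ≤ u := by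
  classical
  have himg : m.leadingTerm '' G = (fun s => monomial s (1 : K)) '' (m.degree '' G) := by
    rw [Set.image_image]
    refine Set.image_congr fun g hg => ?_
    rw [MonomialOrder.leadingTerm, (hm g hg).leadingCoeff_eq_one]
  constructor
  · intro h u hu
    obtain ⟨f, hf, h0, rfl⟩ := notMem_standardExponents_iff.1 hu
    have hmem : m.leadingTerm f ∈ Ideal.span (m.leadingTerm '' G) := by
      rw [h]
      exact Ideal.subset_span ⟨f, hf, rfl⟩
    rw [himg, mem_ideal_span_monomial_image] at hmem
    obtain ⟨_, ⟨g, hg, rfl⟩, hle⟩ := hmem (m.degree f) (by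
      rw [MonomialOrder.leadingTerm, mem_support_iff, coeff_monomial, if_pos rfl]
      exact m.leadingCoeff_ne_zero_iff.2 h0)
    exact ⟨g, hg, hle⟩
  · intro h
    refine le_antisymm (Ideal.span_mono (Set.image_mono hG)) (Ideal.span_le.2 ?_)
    rintro _ ⟨f, hf, rfl⟩
    rw [SetLike.mem_coe, himg, mem_ideal_span_monomial_image]
    intro u hu
    have hu' : u = m.degree f := by
      have := support_monomial_subset hu
      rwa [Finset.mem_singleton] at this
    have h0 : f ≠ 0 := by
      rintro rfl
      simp at hu
    obtain ⟨g, hg, hle⟩ := h u (notMem_standardExponents_iff.2 ⟨f, hf, h0, hu'.symm⟩)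
    exact ⟨_, ⟨g, hg, rfl⟩, hle⟩

lemma toSyn_lt_of_notMem {u r : Fin n →₀ ℕ}
    (hu : u ∉ standardExponents m (latticeIdeal K M))
    (hr : r ∈ standardExponents m (latticeIdeal K M)) (h : Equivalent M u r) :
    m.toSyn r < m.toSyn u := by
  refine lt_of_le_of_ne (mem_standardExponents_iff.1 hr u h.symm) fun he => ?_
  exact hu (m.toSyn.injective he ▸ hr)

lemma isReducedGroebnerBasis_cornerBinomials :
    IsReducedGroebnerBasis m (latticeIdeal K M)
      (cornerBinomials K M (standardExponents m (latticeIdeal K M))) := by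
  classical
  set O := standardExponents m (latticeIdeal K M) with hOdef
  have hO : IsCompatible M O := isCompatible_standardExponents
  have hsub : cornerBinomials K M O ⊆ latticeIdeal K M := by
    rintro _ ⟨c, _, r, _, h, rfl⟩
    exact mono_sub_mono_mem h
  have hmonic : ∀ g ∈ cornerBinomials K M O, m.Monic g := by
    rintro _ ⟨c, hc, r, hr, h, rfl⟩
    exact monic_mono_sub_mono (toSyn_lt_of_notMem hc.1 hr h)
  refine ⟨?_, hsub, ?_, hmonic, ?_⟩
  · choose r hr he using fun u => exists_mem_standardExponents (K := K) (M := M) (m := m) u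
    refine (finite_corners (O := O)).image (fun c => mono K c - mono K (r c)) |>.subset ?_
    rintro _ ⟨c, hc, r', hr', h, rfl⟩
    exact ⟨c, hc, by simp only [hO.2 _ (hr c) _ hr' ((he c).symm.trans h)]⟩
  · rw [span_leadingTerm_eq_iff hsub hmonic]
    intro u hu
    obtain ⟨c, hc, hle⟩ := exists_corner_le hu
    obtain ⟨r, hr, h⟩ := exists_mem_standardExponents (K := K) (M := M) (m := m) c
    refine ⟨_, ⟨c, hc, r, hr, h, rfl⟩, ?_⟩
    rwa [degree_mono_sub_mono (toSyn_lt_of_notMem hc.1 hr h)]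
  · rintro _ ⟨c, hc, r, hr, h, rfl⟩ _ ⟨c', hc', r', hr', h', rfl⟩ hne u hu hle
    rw [degree_mono_sub_mono (toSyn_lt_of_notMem hc'.1 hr' h')] at hle
    rw [support_mono_sub_mono (ne_of_mem_of_not_mem hr hc.1).symm] at hu
    simp only [Finset.mem_insert, Finset.mem_singleton] at hu
    rcases hu with rfl | rfl
    · obtain rfl := corner_eq_of_le hc hc' hle
      exact hne (by rw [hO.2 r hr r' hr' (h.symm.trans h')])
    · exact hc'.1 (hO.1 hle hr)

lemma isReducedGroebnerBasis_iff {G : Set (MvPolynomial (Fin n) K)} :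
    IsReducedGroebnerBasis m (latticeIdeal K M) G ↔
      G = cornerBinomials K M (standardExponents m (latticeIdeal K M)) := by
  classical
  refine ⟨fun hG => ?_, fun h => h ▸ isReducedGroebnerBasis_cornerBinomials⟩
  set O := standardExponents m (latticeIdeal K M) with hOdef
  have hO : IsCompatible M O := isCompatible_standardExponents
  have hspan := (span_leadingTerm_eq_iff hG.subset hG.monic).1 hG.span_leadingTerm
  have hdeg : ∀ g ∈ G, m.degree g ∉ O := fun g hg =>
    notMem_standardExponents_iff.2 ⟨g, hG.subset hg, (hG.monic g hg).ne_zero, rfl⟩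
  have hcorner : ∀ c ∈ corners O, ∃ g ∈ G, m.degree g = c := by
    intro c hc
    obtain ⟨g, hg, hle⟩ := hspan c hc.1
    exact ⟨g, hg, le_antisymm hle (hc.2 (hdeg g hg) hle)⟩
  -- Each corner is a leading exponent in `G`, so reducedness leaves only the element `g` itself as
  -- the one whose leading exponent can divide `u`.
  have hmem : ∀ g ∈ G, ∀ u ∈ g.support, u ∉ O → ∃ c ∈ corners O, c ≤ u ∧ m.degree g = c := by
    intro g hg u hu huO
    obtain ⟨c, hc, hle⟩ := exists_corner_le huO
    obtain ⟨g', hg', rfl⟩ := hcorner c hc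
    by_cases hgg : g = g'
    · exact ⟨_, hc, hle, by rw [hgg]⟩
    · exact absurd hle (hG.reduced g hg g' hg' hgg u hu)
  -- The leading exponent is the only exponent of `g` outside `O`: any other would lie above it, yet
  -- no exponent of `g` exceeds it in the term order.
  have hform : ∀ g ∈ G, ∀ r ∈ O, Equivalent M (m.degree g) r →
      g = mono K (m.degree g) - mono K r := by
    intro g hg r hr h
    refine eq_mono_sub_mono hO (hG.subset hg) hr h fun v hv => ?_
    by_contra hvO
    have hne : v ≠ m.degree g := by
      rintro rfl
      rw [Finset.mem_coe, mem_support_iff, coeff_sub, (hG.monic g hg).coeff_degree] at hv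
      simp [mono] at hv
    have hvg : v ∈ g.support := by
      rw [Finset.mem_coe, mem_support_iff, coeff_sub, mono, coeff_monomial,
        if_neg (Ne.symm hne)] at hv
      rw [mem_support_iff]
      intro h0
      exact hv (by rw [h0, sub_zero])
    obtain ⟨c, -, hle, hcg⟩ := hmem g hg v hvg hvO
    refine hne (m.toSyn.injective (le_antisymm (m.le_degree hvg) ?_))
    rw [hcg]
    exact m.toSyn_monotone hle
  ext g
  constructor
  · intro hg
    obtain ⟨r, hr, h⟩ := exists_mem_standardExponents (K := K) (M := M) (m := m) (m.degree g)
    obtain ⟨c, hc, -, hcg⟩ := hmem g hg _ (m.degree_mem_support (hG.monic g hg).ne_zero) (hdeg g hg)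
    exact ⟨m.degree g, hcg ▸ hc, r, hr, h, hform g hg r hr h⟩
  · rintro ⟨c, hc, r, hr, h, rfl⟩
    obtain ⟨g, hg, rfl⟩ := hcorner c hc
    rwa [← hform g hg r hr h]

end MonomialOrder

variable {O : Set (Fin n →₀ ℕ)} {B : Set (MvPolynomial (Fin n) K)}

lemma corner_mem_border {c : Fin n →₀ ℕ} (hc : c ∈ corners O) (h0 : 0 ∈ O) : c ∈ border O := by
  refine ⟨hc.1, ?_⟩
  have hne : c ≠ 0 := fun h => hc.1 (h ▸ h0)
  obtain ⟨i, hi⟩ := Finsupp.ne_iff.1 hne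
  have hle : Finsupp.single i 1 ≤ c := by
    rw [Finsupp.single_le_iff]
    exact Nat.one_le_iff_ne_zero.2 hi
  obtain ⟨v, rfl⟩ := exists_add_of_le hle
  refine ⟨v, ?_, i, add_comm _ _⟩
  by_contra hv
  have := hc.2 hv le_add_self i
  simp at this

lemma IsBorderBasis.isCompatible (h : IsBorderBasis (latticeIdeal K M) O B) :
    IsCompatible M O := by
  refine ⟨h.isLowerSet, fun u hu v hv he => ?_⟩
  have : (⟨u, hu⟩ : O) = ⟨v, hv⟩ := h.linearIndependent.injective
    (Ideal.Quotient.eq.2 (mono_sub_mono_mem he))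
  exact congrArg Subtype.val this

/-- If `O` missed the class of `u`, a combination `f` of monomials of `O` with the same residue as
`x^u` would give `f - x^u` in the ideal with class sum `-1` at `u`. -/
lemma IsBorderBasis.exists_equivalent (h : IsBorderBasis (latticeIdeal K M) O B)
    (u : Fin n →₀ ℕ) : ∃ r ∈ O, Equivalent M u r := by
  classical
  by_contra! hu
  have hmem : ∀ q ∈ Submodule.span K
      (Set.range fun u : O => Ideal.Quotient.mk (latticeIdeal K M) (mono K u.1)),
      ∃ f : MvPolynomial (Fin n) K, (f.support : Set (Fin n →₀ ℕ)) ⊆ O ∧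
        Ideal.Quotient.mk _ f = q := by
    intro q hq
    induction hq using Submodule.span_induction with
    | mem x hx =>
      obtain ⟨v, rfl⟩ := hx
      refine ⟨mono K v.1, fun w hw => ?_, rfl⟩
      have := support_monomial_subset hw
      rw [Finset.mem_singleton] at this
      exact this ▸ v.2
    | zero => exact ⟨0, by simp, map_zero _⟩
    | add x y _ _ hx hy =>
      obtain ⟨f, hf, rfl⟩ := hx
      obtain ⟨g, hg, rfl⟩ := hy
      refine ⟨f + g, fun w hw => ?_, map_add _ _ _⟩
      rcases Finset.mem_union.1 (support_add hw) with hw | hw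
      exacts [hf hw, hg hw]
    | smul a x _ hx =>
      obtain ⟨f, hf, rfl⟩ := hx
      exact ⟨a • f, fun w hw => hf (support_smul hw), rfl⟩
  obtain ⟨f, hf, hq⟩ := hmem (Ideal.Quotient.mk _ (mono K u)) (by rw [h.span_eq_top]; trivial)
  have hI := Ideal.Quotient.eq.1 hq
  have h1 : classSum K M u f = f.coeff u :=
    classSum_eq_coeff fun v hv he => absurd he.symm (hu v (hf hv))
  have h2 := classSum_eq_zero hI u
  have h3 : f.coeff u = 0 := by
    by_contra h3
    exact hu u (hf (mem_support_iff.2 h3)) (Equivalent.refl u)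
  rw [map_sub, h1, h3, mono, classSum_monomial, if_pos (Equivalent.refl u)] at h2
  simp at h2

lemma IsBorderBasis.isMaximalCompatible (h : IsBorderBasis (latticeIdeal K M) O B) :
    IsMaximalCompatible M O :=
  h.isCompatible.isMaximalCompatible h.exists_equivalent

lemma IsBorderBasis.cornerPart_eq (h : IsBorderBasis (latticeIdeal K M) O B) :
    cornerPart O B = cornerBinomials K M O := by
  classical
  obtain ⟨g, hg, rfl⟩ := h.eq_image
  have hform : ∀ b ∈ border O, ∀ r ∈ O, Equivalent M b r → g b = mono K b - mono K r :=
    fun b hb r hr he => eq_mono_sub_mono h.isCompatible (hg b hb).1 hr he (hg b hb).2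
  ext f
  constructor
  · rintro ⟨⟨b, hb, rfl⟩, c, hc, hcs⟩
    obtain ⟨r, hr, he⟩ := h.exists_equivalent b
    rw [hform b hb r hr he] at hcs ⊢
    rw [support_mono_sub_mono (ne_of_mem_of_not_mem hr hb.1).symm] at hcs
    simp only [Finset.mem_insert, Finset.mem_singleton] at hcs
    rcases hcs with rfl | rfl
    · exact ⟨c, hc, r, hr, he, rfl⟩
    · exact absurd hr hc.1
  · rintro ⟨c, hc, r, hr, he, rfl⟩
    have hb := corner_mem_border hc h.isMaximalCompatible.zero_mem
    refine ⟨⟨c, hb, hform c hb r hr he⟩, c, hc, ?_⟩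
    rw [support_mono_sub_mono (ne_of_mem_of_not_mem hr hc.1).symm]
    simp

lemma exists_isBorderBasis (hO : IsCompatible M O) (hc : ∀ u, ∃ r ∈ O, Equivalent M u r) :
    ∃ B, IsBorderBasis (latticeIdeal K M) O B := by
  classical
  choose r hr he using hc
  refine ⟨_, hO.1, ?_, ?_, fun b => mono K b - mono K (r b), fun b _ =>
    ⟨mono_sub_mono_mem (he b), fun w hw => ?_⟩, rfl⟩
  · rw [linearIndependent_iff]
    intro l hl
    -- A relation between residue classes lifts to a polynomial of the ideal supported in `O`, which
    -- must vanish.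
    set f : MvPolynomial (Fin n) K := l.sum fun v a => monomial v.1 a with hf
    have hcoeff : ∀ v : O, f.coeff v.1 = l v := by
      intro v
      rw [hf, Finsupp.sum, coeff_sum, Finset.sum_eq_single v]
      · simp
      · intro w _ hne
        rw [coeff_monomial, if_neg fun e => hne (Subtype.ext e)]
      · intro hv
        simp [Finsupp.notMem_support_iff.1 hv]
    have hsupp : (f.support : Set (Fin n →₀ ℕ)) ⊆ O := by
      intro w hw
      by_contra hwO
      refine mem_support_iff.1 hw ?_
      rw [hf, Finsupp.sum, coeff_sum]
      refine Finset.sum_eq_zero fun v _ => ?_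
      rw [coeff_monomial, if_neg]
      rintro rfl
      exact hwO v.2
    have hI : f ∈ latticeIdeal K M := by
      rw [← Ideal.Quotient.eq_zero_iff_mem, ← hl, hf, Finsupp.linearCombination_apply,
        Finsupp.sum, Finsupp.sum, map_sum]
      refine Finset.sum_congr rfl fun v _ => ?_
      have : monomial v.1 (l v) = l v • mono K v.1 := by simp [mono, smul_monomial]
      rw [this]
      rfl
    ext v
    rw [← hcoeff v, eq_zero_of_support_subset hI hO hsupp]
    simp
  · rw [eq_top_iff]
    rintro q -
    obtain ⟨f, rfl⟩ := Ideal.Quotient.mk_surjective q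
    induction f using MvPolynomial.induction_on' with
    | monomial u a =>
      have h1 : monomial u a = a • mono K u := by simp [mono, smul_monomial]
      have h2 : Ideal.Quotient.mk (latticeIdeal K M) (monomial u a) =
          a • Ideal.Quotient.mk (latticeIdeal K M) (mono K (r u)) := by
        rw [← Ideal.Quotient.eq.2 (mono_sub_mono_mem (K := K) (he u)), h1]
        rfl
      rw [h2]
      exact Submodule.smul_mem _ _ (Submodule.subset_span ⟨⟨r u, hr u⟩, rfl⟩)
    | add p q hp hq =>
      rw [map_add]
      exact Submodule.add_mem _ hp hq
  · rw [sub_sub_cancel] at hw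
    have := support_monomial_subset hw
    rw [Finset.mem_singleton] at this
    exact this ▸ hr b

end General

/-- If both had a positive `i`-th coordinate, subtracting the unit vector would land both in `O`,
still congruent, hence equal; then the corner would lie in `O`. -/
lemma corner_disjoint {n : ℕ} {M : Submodule ℤ (Fin n → ℤ)}
    {O : Set (Fin n →₀ ℕ)} (hO : IsCompatible M O) {c r : Fin n →₀ ℕ}
    (hc : c ∈ corners O) (hr : r ∈ O) (h : Equivalent M c r) (i : Fin n) : c i = 0 ∨ r i = 0 := by
  by_contra! hi
  have hle : ∀ u : Fin n →₀ ℕ, u i ≠ 0 → ∃ v, u = v + Finsupp.single i 1 := by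
    intro u hu
    obtain ⟨v, hv⟩ := exists_add_of_le ((Finsupp.single_le_iff).2 (Nat.one_le_iff_ne_zero.2 hu))
    exact ⟨v, by rw [hv, add_comm]⟩
  obtain ⟨c, rfl⟩ := hle c hi.1
  obtain ⟨r, rfl⟩ := hle r hi.2
  have hcO : c ∈ O := by
    by_contra hcO
    have := hc.2 hcO le_self_add i
    simp at this
  rw [equivalent_add_right_iff] at h
  obtain rfl := hO.2 c hcO r (hO.1 le_self_add hr) h
  exact hc.1 hr

/-! ### Shape of maximal compatible order ideals in the plane -/

section Plane

variable {M : Submodule ℤ (Fin 2 → ℤ)} {O : Set (Fin 2 →₀ ℕ)}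

@[simp] lemma pt_zero_coord (p q : ℕ) : pt p q 0 = p := rfl

@[simp] lemma pt_one_coord (p q : ℕ) : pt p q 1 = q := rfl

lemma eq_pt (u : Fin 2 →₀ ℕ) : u = pt (u 0) (u 1) := by
  ext i; fin_cases i <;> rfl

lemma le_iff_coord {u v : Fin 2 →₀ ℕ} : u ≤ v ↔ u 0 ≤ v 0 ∧ u 1 ≤ v 1 := by
  rw [Finsupp.le_def, Fin.forall_fin_two]

lemma eq_iff_coord {u v : Fin 2 →₀ ℕ} : u = v ↔ u 0 = v 0 ∧ u 1 = v 1 := by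
  rw [Finsupp.ext_iff, Fin.forall_fin_two]

lemma pt_zero_zero : pt 0 0 = 0 := by
  rw [eq_iff_coord]; simp

lemma equivalent_iff_coord {u v : Fin 2 →₀ ℕ} :
    Equivalent M u v ↔ ![(u 0 : ℤ) - v 0, (u 1 : ℤ) - v 1] ∈ M := by
  have : toInt u - toInt v = ![(u 0 : ℤ) - v 0, (u 1 : ℤ) - v 1] := by
    ext i; fin_cases i <;> rfl
  rw [Equivalent, this]

lemma mono_pt (K : Type*) [Field K] (p q : ℕ) : mono K (pt p q) = X 0 ^ p * X 1 ^ q := by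
  have : pt p q = Finsupp.single 0 p + Finsupp.single 1 q := by
    rw [eq_iff_coord]; simp
  rw [mono, this, X_pow_eq_monomial, X_pow_eq_monomial, monomial_mul, one_mul]

/-- Term orders refining a positive weight. -/
lemma exists_weight_order (w₁ w₂ : ℕ) (h₂ : 0 < w₂) :
    ∃ m : MonomialOrder.{0, 0} (Fin 2), ∀ u v : Fin 2 →₀ ℕ,
      w₁ * u 0 + w₂ * u 1 < w₁ * v 0 + w₂ * v 1 → m.toSyn u < m.toSyn v := by
  -- Compare weights and break ties by the first coordinate. Since `w₂` is positive, this pair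
  -- determines the exponent, and the range of `φ` serves as the well-ordered monoid of the term
  -- order.
  let φ : (Fin 2 →₀ ℕ) →+ ℕ ×ₗ ℕ :=
    { toFun := fun u => toLex (w₁ * u 0 + w₂ * u 1, u 0)
      map_zero' := by simp
      map_add' := fun u v => by
        rw [← toLex_add, Prod.mk_add_mk]
        simp only [Finsupp.add_apply]
        congr 2
        ring }
  have hφ : Function.Injective φ := by
    intro u v h
    have h' : (w₁ * u 0 + w₂ * u 1, u 0) = (w₁ * v 0 + w₂ * v 1, v 0) := toLex.injective h
    rw [Prod.mk.injEq] at h'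
    obtain ⟨h1, h0⟩ := h'
    rw [h0] at h1
    exact eq_iff_coord.2 ⟨h0, Nat.eq_of_mul_eq_mul_left h₂ (Nat.add_left_cancel h1)⟩
  have hmono : Monotone φ := by
    intro u v h
    rw [le_iff_coord] at h
    refine Prod.Lex.toLex_le_toLex.2 ?_
    have : w₁ * u 0 + w₂ * u 1 ≤ w₁ * v 0 + w₂ * v 1 :=
      add_le_add (Nat.mul_le_mul_left _ h.1) (Nat.mul_le_mul_left _ h.2)
    rcases this.lt_or_eq with hlt | heq
    · exact Or.inl hlt
    · exact Or.inr ⟨heq, h.1⟩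
  have hwf : WellFoundedLT (AddMonoidHom.mrange φ) :=
    ⟨InvImage.wf (fun x : AddMonoidHom.mrange φ => (x : ℕ ×ₗ ℕ)) wellFounded_lt⟩
  let e : (Fin 2 →₀ ℕ) ≃+ AddMonoidHom.mrange φ :=
    AddEquiv.ofBijective φ.mrangeRestrict
      ⟨fun u v h => hφ (congrArg Subtype.val h), φ.mrangeRestrict_surjective⟩
  refine ⟨{ syn := AddMonoidHom.mrange φ, toSyn := e, toSyn_monotone := fun u v h => hmono h },
    fun u v h => ?_⟩
  change φ u < φ v
  exact Prod.Lex.toLex_lt_toLex.2 (Or.inl h)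

/-- The corners of `O` on the two axes together with their representatives, in the situation that
all other corners are congruent to `0`. -/
structure IsFrame (M : Submodule ℤ (Fin 2 → ℤ)) (O : Set (Fin 2 →₀ ℕ)) (α α' β β' : ℕ) : Prop where
  corner_fst : pt α 0 ∈ corners O
  corner_snd : pt 0 β ∈ corners O
  mem_fst : pt 0 α' ∈ O
  mem_snd : pt β' 0 ∈ O
  equiv_fst : Equivalent M (pt α 0) (pt 0 α')
  equiv_snd : Equivalent M (pt 0 β) (pt β' 0)
  corner_cases : ∀ c ∈ corners O, c = pt α 0 ∨ c = pt 0 β ∨ (0 < c 0 ∧ 0 < c 1 ∧ Equivalent M c 0)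

lemma IsMaximalCompatible.exists_isFrame (hO : IsMaximalCompatible M O)
    (h₀ : ∃ d : ℕ, 0 < d ∧ ![(d : ℤ), 0] ∈ M) (h₁ : ∃ d : ℕ, 0 < d ∧ ![0, (d : ℤ)] ∈ M) :
    ∃ α α' β β', IsFrame M O α α' β β' := by
  have hzero := hO.zero_mem
  obtain ⟨d, hd, hdM⟩ := h₀
  obtain ⟨e, he, heM⟩ := h₁
  have hdO : pt d 0 ∉ O := by
    intro h
    have := hO.1.2 _ h _ hzero (equivalent_iff_coord.2 (by simpa using hdM))
    rw [eq_iff_coord] at this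
    simp at this
    omega
  have heO : pt 0 e ∉ O := by
    intro h
    have := hO.1.2 _ h _ hzero (equivalent_iff_coord.2 (by simpa using heM))
    rw [eq_iff_coord] at this
    simp at this
    omega
  obtain ⟨A, hA, hAd⟩ := exists_corner_le hdO
  obtain ⟨B, hB, hBe⟩ := exists_corner_le heO
  rw [le_iff_coord] at hAd hBe
  simp only [pt_zero_coord, pt_one_coord, Nat.le_zero] at hAd hBe
  have hA' := eq_pt A
  have hB' := eq_pt B
  rw [hAd.2] at hA'
  rw [hBe.1] at hB'
  have hApos : A 0 ≠ 0 := by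
    intro h
    rw [h, pt_zero_zero] at hA'
    exact hA.1 (hA' ▸ hzero)
  have hBpos : B 1 ≠ 0 := by
    intro h
    rw [h, pt_zero_zero] at hB'
    exact hB.1 (hB' ▸ hzero)
  obtain ⟨r, hr, hrA⟩ := hO.exists_rep_corner hA
  obtain ⟨s, hs, hsB⟩ := hO.exists_rep_corner hB
  -- Disjoint supports push the representative of an axis corner onto the other axis.
  have hr0 := (corner_disjoint hO.1 hA hr hrA 0).resolve_left hApos
  have hs1 := (corner_disjoint hO.1 hB hs hsB 1).resolve_left hBpos
  have hr' := eq_pt r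
  have hs' := eq_pt s
  rw [hr0] at hr'
  rw [hs1] at hs'
  refine ⟨A 0, r 1, B 1, s 0, hA' ▸ hA, hB' ▸ hB, hr' ▸ hr, hs' ▸ hs, ?_, ?_, ?_⟩
  · rwa [← hA', ← hr']
  · rwa [← hB', ← hs']
  · intro c hc
    rw [← hA', ← hB']
    by_cases hc1 : c 1 = 0
    · left
      rcases le_total (c 0) (A 0) with h | h
      · exact corner_eq_of_le hA hc (le_iff_coord.2 ⟨h, by omega⟩)
      · exact (corner_eq_of_le hc hA (le_iff_coord.2 ⟨h, by omega⟩)).symm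
    · right
      by_cases hc0 : c 0 = 0
      · left
        rcases le_total (c 1) (B 1) with h | h
        · exact corner_eq_of_le hB hc (le_iff_coord.2 ⟨by omega, h⟩)
        · exact (corner_eq_of_le hc hB (le_iff_coord.2 ⟨by omega, h⟩)).symm
      · right
        obtain ⟨t, ht, htc⟩ := hO.exists_rep_corner hc
        have ht0 := (corner_disjoint hO.1 hc ht htc 0).resolve_left hc0
        have ht1 := (corner_disjoint hO.1 hc ht htc 1).resolve_left hc1
        have ht' := eq_pt t
        rw [ht0, ht1, pt_zero_zero] at ht'
        exact ⟨by omega, by omega, ht' ▸ htc⟩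

namespace IsFrame

variable {α α' β β' : ℕ}

lemma mem_fst_iff (hF : IsFrame M O α α' β β') (hO : IsLowerSet O) {p : ℕ} :
    pt p 0 ∈ O ↔ p < α := by
  constructor
  · intro hp
    by_contra! h
    exact hF.corner_fst.1 (hO (a := pt p 0) (le_iff_coord.2 ⟨h, le_rfl⟩) hp)
  · intro hp
    by_contra h
    have := hF.corner_fst.2 h (le_iff_coord.2 ⟨hp.le, le_rfl⟩)
    rw [le_iff_coord] at this
    simp at this
    omega

lemma mem_snd_iff (hF : IsFrame M O α α' β β') (hO : IsLowerSet O) {q : ℕ} :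
    pt 0 q ∈ O ↔ q < β := by
  constructor
  · intro hq
    by_contra! h
    exact hF.corner_snd.1 (hO (a := pt 0 q) (le_iff_coord.2 ⟨le_rfl, h⟩) hq)
  · intro hq
    by_contra h
    have := hF.corner_snd.2 h (le_iff_coord.2 ⟨le_rfl, hq.le⟩)
    rw [le_iff_coord] at this
    simp at this
    omega

lemma lt_snd (hF : IsFrame M O α α' β β') (hO : IsLowerSet O) : α' < β :=
  (hF.mem_snd_iff hO).1 hF.mem_fst

lemma lt_fst (hF : IsFrame M O α α' β β') (hO : IsLowerSet O) : β' < α :=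
  (hF.mem_fst_iff hO).1 hF.mem_snd

lemma exists_eq_standardExponents (K : Type*) [Field K] (hF : IsFrame M O α α' β β')
    (hO : IsMaximalCompatible M O) :
    ∃ m : MonomialOrder.{0, 0} (Fin 2), O = standardExponents m (latticeIdeal K M) := by
  have h1 := hF.lt_snd hO.1.1
  have h2 := hF.lt_fst hO.1.1
  -- With this weight both axis corners exceed their representatives by the same amount, αβ - α'β' >
  -- 0.
  obtain ⟨m, hm⟩ := exists_weight_order (α' + β) (α + β') (by omega)
  refine ⟨m, ((isMaximalCompatible_standardExponents m).eq_of_subset hO fun u hu => ?_).symm⟩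
  by_contra huO
  obtain ⟨c, hc, hcu⟩ := exists_corner_le huO
  have hcs := isCompatible_standardExponents.1 hcu hu
  rw [mem_standardExponents_iff] at hcs
  have key : ∃ r, Equivalent M c r ∧
      (α' + β) * r 0 + (α + β') * r 1 < (α' + β) * c 0 + (α + β') * c 1 := by
    rcases hF.corner_cases c hc with rfl | rfl | ⟨hc0, hc1, hcz⟩
    · refine ⟨_, hF.equiv_fst, ?_⟩
      simp only [pt_zero_coord, pt_one_coord]
      nlinarith
    · refine ⟨_, hF.equiv_snd, ?_⟩
      simp only [pt_zero_coord, pt_one_coord]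
      nlinarith
    · refine ⟨0, hcz, ?_⟩
      simp only [Finsupp.coe_zero, Pi.zero_apply, mul_zero, add_zero]
      have : 0 < (α' + β) * c 0 := Nat.mul_pos (by omega) hc0
      omega
  obtain ⟨r, hr, hlt⟩ := key
  exact absurd (hcs r hr) (not_le.2 (hm r c hlt))

lemma mem_of_corner {c : Fin 2 →₀ ℕ} (hc : c ∈ corners O) {u : Fin 2 →₀ ℕ} (hle : u ≤ c)
    (hne : u ≠ c) : u ∈ O := by
  by_contra hu
  exact hne (le_antisymm hle (hc.2 hu hle))

/-- Both corners are congruent to 0, hence to each other. Cancelling their meet `(c 0, c' 1)` leaves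
congruent nonzero points on different axes, each strictly below a corner and so in `O`: a
contradiction. -/
lemma inclined_not_lt (hO : IsCompatible M O) {c c' : Fin 2 →₀ ℕ} (hc : c ∈ corners O)
    (hc' : c' ∈ corners O) (h : 0 < c 0 ∧ 0 < c 1 ∧ Equivalent M c 0)
    (h' : 0 < c' 0 ∧ 0 < c' 1 ∧ Equivalent M c' 0) : ¬ c 0 < c' 0 := by
  intro hlt
  have hlt1 : c' 1 < c 1 := by
    by_contra! hle
    have := corner_eq_of_le hc' hc (le_iff_coord.2 ⟨hlt.le, hle⟩)
    rw [this] at hlt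
    exact lt_irrefl _ hlt
  have e1 : pt (c' 0 - c 0) 0 + pt (c 0) (c' 1) = c' := by
    rw [eq_iff_coord]; simp; omega
  have e2 : pt 0 (c 1 - c' 1) + pt (c 0) (c' 1) = c := by
    rw [eq_iff_coord]; simp; omega
  have he : Equivalent M (pt (c' 0 - c 0) 0) (pt 0 (c 1 - c' 1)) := by
    rw [← equivalent_add_right_iff (w := pt (c 0) (c' 1)), e1, e2]
    exact h'.2.2.trans h.2.2.symm
  have m1 : pt (c' 0 - c 0) 0 ∈ O := mem_of_corner hc'
    (le_iff_coord.2 (by simp)) (by rw [Ne, eq_iff_coord]; simp; omega)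
  have m2 : pt 0 (c 1 - c' 1) ∈ O := mem_of_corner hc
    (le_iff_coord.2 (by simp)) (by rw [Ne, eq_iff_coord]; simp; omega)
  have := hO.2 _ m1 _ m2 he
  rw [eq_iff_coord] at this
  simp at this
  omega

lemma inclined_unique (hO : IsCompatible M O) {c c' : Fin 2 →₀ ℕ} (hc : c ∈ corners O)
    (hc' : c' ∈ corners O) (h : 0 < c 0 ∧ 0 < c 1 ∧ Equivalent M c 0)
    (h' : 0 < c' 0 ∧ 0 < c' 1 ∧ Equivalent M c' 0) : c = c' := by
  have h1 := inclined_not_lt hO hc hc' h h'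
  have h2 := inclined_not_lt hO hc' hc h' h
  rcases le_total (c 1) (c' 1) with h3 | h3
  · exact corner_eq_of_le hc' hc (le_iff_coord.2 ⟨by omega, h3⟩)
  · exact (corner_eq_of_le hc hc' (le_iff_coord.2 ⟨by omega, h3⟩)).symm

lemma eq_rect (hF : IsFrame M O α α' β β') (hO : IsLowerSet O)
    (hc : ∀ c ∈ corners O, c = pt α 0 ∨ c = pt 0 β) : O = rect α β := by
  ext u
  constructor
  · intro hu
    exact ⟨(hF.mem_fst_iff hO).1 (hO (le_iff_coord.2 (by simp)) hu),
      (hF.mem_snd_iff hO).1 (hO (le_iff_coord.2 (by simp)) hu)⟩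
  · rintro ⟨h0, h1⟩
    by_contra hu
    obtain ⟨c, hcO, hle⟩ := exists_corner_le hu
    rw [le_iff_coord] at hle
    rcases hc c hcO with rfl | rfl <;> simp at hle <;> omega

lemma fst_eq_zero_or_snd_eq_zero (hF : IsFrame M O α α' β β') (hO : IsCompatible M O)
    (hrect : O = rect α β) : α' = 0 ∨ β' = 0 := by
  by_contra! h
  have h1 := hF.lt_snd hO.1
  have h2 := hF.lt_fst hO.1
  -- The sum of the two axis congruences makes this point congruent to 0; it lies in the rectangle
  -- once α' and β' are both positive.
  have hmem : pt (α - β') (β - α') ∈ O := by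
    rw [hrect]
    constructor <;> simp <;> omega
  have hzero : (0 : Fin 2 →₀ ℕ) ∈ O := hO.1 (by simp) hmem
  have he : Equivalent M (pt (α - β') (β - α')) 0 := by
    have := M.add_mem (equivalent_iff_coord.1 hF.equiv_fst) (equivalent_iff_coord.1 hF.equiv_snd)
    rw [equivalent_iff_coord]
    convert this using 1
    ext i
    fin_cases i <;> simp <;> omega
  have := hO.2 _ hmem _ hzero he
  rw [eq_iff_coord] at this
  simp at this
  omega

end IsFrame

/-- A maximal compatible order ideal in the plane is a rectangle, or it has exactly one corner off
the axes. -/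
lemma IsFrame.rect_or_inclined {α α' β β' : ℕ} (hF : IsFrame M O α α' β β')
    (hO : IsCompatible M O) :
    (O = rect α β ∧ (α' = 0 ∨ β' = 0)) ∨
      ∃ γ₁ γ₂, 0 < γ₁ ∧ 0 < γ₂ ∧ Equivalent M (pt γ₁ γ₂) 0 ∧
        corners O = {pt α 0, pt 0 β, pt γ₁ γ₂} := by
  by_cases h : ∀ c ∈ corners O, c = pt α 0 ∨ c = pt 0 β
  · have hr := hF.eq_rect hO.1 h
    exact Or.inl ⟨hr, hF.fst_eq_zero_or_snd_eq_zero hO hr⟩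
  · right
    push Not at h
    obtain ⟨c, hc, hcA, hcB⟩ := h
    have hci := ((hF.corner_cases c hc).resolve_left hcA).resolve_left hcB
    have hcpt := eq_pt c
    refine ⟨c 0, c 1, hci.1, hci.2.1, hcpt ▸ hci.2.2, ?_⟩
    rw [← hcpt]
    ext c'
    simp only [Set.mem_insert_iff, Set.mem_singleton_iff]
    constructor
    · intro hc'
      rcases hF.corner_cases c' hc' with h | h | h
      · exact Or.inl h
      · exact Or.inr (Or.inl h)
      · exact Or.inr (Or.inr (IsFrame.inclined_unique hO hc' hc h hci))
    · rintro (rfl | rfl | rfl)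
      exacts [hF.corner_fst, hF.corner_snd, hc]

end Plane

/-! ### Recovering the order ideal from its corner binomials -/

section General

variable {n : ℕ} {K : Type*} [Field K] {M : Submodule ℤ (Fin n → ℤ)} {O : Set (Fin n →₀ ℕ)}

lemma binomials_eq_singleton (hO : IsCompatible M O) {c r : Fin n →₀ ℕ} (hr : r ∈ O)
    (h : Equivalent M c r) (f : MvPolynomial (Fin n) K) :
    (∃ r' ∈ O, Equivalent M c r' ∧ f = mono K c - mono K r') ↔ f = mono K c - mono K r := by
  constructor
  · rintro ⟨r', hr', h', rfl⟩
    rw [hO.2 r' hr' r hr (h'.symm.trans h)]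
  · rintro rfl
    exact ⟨r, hr, h, rfl⟩

lemma ncard_cornerBinomials (hO : IsCompatible M O)
    (hc : ∀ c ∈ corners O, ∃ r ∈ O, Equivalent M c r) :
    (cornerBinomials K M O).ncard = (corners O).ncard := by
  choose! r hr he using hc
  have himg : cornerBinomials K M O = (fun c => mono K c - mono K (r c)) '' corners O := by
    ext f
    constructor
    · rintro ⟨c, hc, h⟩
      exact ⟨c, hc, ((binomials_eq_singleton hO (hr c hc) (he c hc) f).1 h).symm⟩
    · rintro ⟨c, hc, rfl⟩
      exact ⟨c, hc, r c, hr c hc, he c hc, rfl⟩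
  rw [himg]
  refine Set.InjOn.ncard_image fun c hc c' hc' h => ?_
  exact mono_sub_mono_inj hc.1 (hr c' hc') (hr c hc) hc'.1 h

lemma cornerBinomials_pair (hO : IsCompatible M O) {A A' B B' : Fin n →₀ ℕ}
    (hcorn : corners O = {A, B}) (hA' : A' ∈ O) (hB' : B' ∈ O) (hA : Equivalent M A A')
    (hB : Equivalent M B B') :
    cornerBinomials K M O = {mono K A - mono K A', mono K B - mono K B'} := by
  ext f
  simp only [cornerBinomials, hcorn, Set.mem_ofPred_eq, Set.mem_insert_iff, Set.mem_singleton_iff,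
    exists_eq_or_imp, exists_eq_left, binomials_eq_singleton hO hA' hA,
    binomials_eq_singleton hO hB' hB]

lemma cornerBinomials_triple (hO : IsCompatible M O) {A A' B B' C C' : Fin n →₀ ℕ}
    (hcorn : corners O = {A, B, C}) (hA' : A' ∈ O) (hB' : B' ∈ O) (hC' : C' ∈ O)
    (hA : Equivalent M A A') (hB : Equivalent M B B') (hC : Equivalent M C C') :
    cornerBinomials K M O =
      {mono K A - mono K A', mono K B - mono K B', mono K C - mono K C'} := by
  ext f
  simp only [cornerBinomials, hcorn, Set.mem_ofPred_eq, Set.mem_insert_iff, Set.mem_singleton_iff,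
    exists_eq_or_imp, exists_eq_left, binomials_eq_singleton hO hA' hA,
    binomials_eq_singleton hO hB' hB, binomials_eq_singleton hO hC' hC]

/-- Equal binomials have equal two-element supports, so corner and representative either match or,
as signs are invisible in the support, exchange roles. -/
lemma exists_corner_of_cornerBinomials_eq {O' : Set (Fin n →₀ ℕ)}
    (hO' : IsMaximalCompatible M O')
    (h : cornerBinomials K M O = cornerBinomials K M O') {c : Fin n →₀ ℕ} (hc : c ∈ corners O') :
    c ∈ corners O ∨ c ∈ O ∧ ∃ c₁ ∈ corners O, c₁ ∈ O' ∧ Equivalent M c₁ c := by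
  obtain ⟨r, hr, he⟩ := hO'.exists_rep_corner hc
  have hmem : mono K c - mono K r ∈ cornerBinomials K M O := by
    rw [h]
    exact ⟨c, hc, r, hr, he, rfl⟩
  obtain ⟨c₁, hc₁, r₁, hr₁, he₁, heq⟩ := hmem
  have hs := congrArg support heq
  rw [support_mono_sub_mono (ne_of_mem_of_not_mem hr hc.1).symm,
    support_mono_sub_mono (ne_of_mem_of_not_mem hr₁ hc₁.1).symm] at hs
  have h1 : c ∈ ({c₁, r₁} : Finset _) := by rw [← hs]; simp
  have h2 : c₁ ∈ ({c, r} : Finset _) := by rw [hs]; simp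
  simp only [Finset.mem_insert, Finset.mem_singleton] at h1 h2
  rcases h1 with rfl | rfl
  · exact Or.inl hc₁
  · rcases h2 with rfl | rfl
    · exact Or.inl hc₁
    · exact Or.inr ⟨hr₁, _, hc₁, hr, he₁⟩

end General

section Plane

variable {K : Type*} [Field K] {M : Submodule ℤ (Fin 2 → ℤ)} {O O' : Set (Fin 2 →₀ ℕ)}
variable {α α' β β' γ γ' δ δ' : ℕ}

lemma IsFrame.fst_le_of_cornerBinomials_eq (hF : IsFrame M O α α' β β')
    (hF' : IsFrame M O' γ γ' δ δ') (hO : IsCompatible M O) (hO' : IsMaximalCompatible M O')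
    (h : cornerBinomials K M O = cornerBinomials K M O') : γ ≤ α := by
  rcases exists_corner_of_cornerBinomials_eq hO' h hF'.corner_fst with hc | ⟨hc, -⟩
  · by_contra! hlt
    have := corner_eq_of_le hc hF.corner_fst (le_iff_coord.2 ⟨hlt.le, le_rfl⟩)
    rw [eq_iff_coord] at this
    simp at this
    omega
  · exact ((hF.mem_fst_iff hO.1).1 hc).le

lemma IsFrame.snd_le_of_cornerBinomials_eq (hF : IsFrame M O α α' β β')
    (hF' : IsFrame M O' γ γ' δ δ') (hO : IsCompatible M O) (hO' : IsMaximalCompatible M O')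
    (h : cornerBinomials K M O = cornerBinomials K M O') : δ ≤ β := by
  rcases exists_corner_of_cornerBinomials_eq hO' h hF'.corner_snd with hc | ⟨hc, -⟩
  · by_contra! hlt
    have := corner_eq_of_le hc hF.corner_snd (le_iff_coord.2 ⟨le_rfl, hlt.le⟩)
    rw [eq_iff_coord] at this
    simp at this
    omega
  · exact ((hF.mem_snd_iff hO.1).1 hc).le

/-- The axis corners agree. A corner of `O'` inside `O` must have exchanged roles with a corner `c₁`
of `O` lying in `O'`; the shared axis corners are excluded, so `c₁` is congruent to 0, which makes
the corner of `O'` equal to 0. -/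
lemma eq_of_cornerBinomials_eq (hO : IsMaximalCompatible M O) (hO' : IsMaximalCompatible M O')
    (hF : IsFrame M O α α' β β') (hF' : IsFrame M O' γ γ' δ δ')
    (h : cornerBinomials K M O = cornerBinomials K M O') : O = O' := by
  have e1 : γ = α := le_antisymm (hF.fst_le_of_cornerBinomials_eq hF' hO.1 hO' h)
    (hF'.fst_le_of_cornerBinomials_eq hF hO'.1 hO h.symm)
  have e2 : δ = β := le_antisymm (hF.snd_le_of_cornerBinomials_eq hF' hO.1 hO' h)
    (hF'.snd_le_of_cornerBinomials_eq hF hO'.1 hO h.symm)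
  subst e1 e2
  refine hO.eq_of_subset hO' fun u hu => ?_
  by_contra huO'
  obtain ⟨c, hc, hle⟩ := exists_corner_le huO'
  rcases exists_corner_of_cornerBinomials_eq hO' h hc with hcO | ⟨hcO, c₁, hc₁, hc₁O', he⟩
  · exact hcO.1 (hO.1.1 hle hu)
  · rcases hF.corner_cases c₁ hc₁ with rfl | rfl | ⟨-, -, hz⟩
    · exact hF'.corner_fst.1 hc₁O'
    · exact hF'.corner_snd.1 hc₁O'
    · have := hO.1.2 c hcO 0 hO.zero_mem (he.symm.trans hz)
      rw [this] at hc
      exact hc.1 hO'.zero_mem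

/-! ### Rectangles -/

section Rectangles

variable {a b : ℕ}

lemma isLowerSet_rect : IsLowerSet (rect a b) := by
  intro u v hvu hu
  rw [le_iff_coord] at hvu
  exact ⟨hvu.1.trans_lt hu.1, hvu.2.trans_lt hu.2⟩

lemma corners_rect (ha : 0 < a) (hb : 0 < b) : corners (rect a b) = {pt a 0, pt 0 b} := by
  have hA : pt a 0 ∈ corners (rect a b) := by
    refine ⟨fun h => absurd h.1 (by simp), fun v hv hle => ?_⟩
    rw [le_iff_coord] at hle ⊢
    simp only [pt_zero_coord, pt_one_coord] at hle ⊢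
    refine ⟨?_, by omega⟩
    by_contra! hlt
    exact hv ⟨hlt, by omega⟩
  have hB : pt 0 b ∈ corners (rect a b) := by
    refine ⟨fun h => absurd h.2 (by simp), fun v hv hle => ?_⟩
    rw [le_iff_coord] at hle ⊢
    simp only [pt_zero_coord, pt_one_coord] at hle ⊢
    refine ⟨by omega, ?_⟩
    by_contra! hlt
    exact hv ⟨by omega, hlt⟩
  ext c
  simp only [Set.mem_insert_iff, Set.mem_singleton_iff]
  constructor
  · intro hc
    by_cases h : a ≤ c 0
    · exact Or.inl (corner_eq_of_le hc hA (le_iff_coord.2 ⟨h, by simp⟩)).symm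
    · have h' : b ≤ c 1 := by
        by_contra! hlt
        exact hc.1 ⟨by omega, hlt⟩
      exact Or.inr (corner_eq_of_le hc hB (le_iff_coord.2 ⟨by simp, h'⟩)).symm
  · rintro (rfl | rfl)
    exacts [hA, hB]

lemma pt_fst_ne_pt_snd (ha : 0 < a) : pt a 0 ≠ pt 0 b := by
  rw [Ne, eq_iff_coord]
  simp
  omega

lemma ncard_corners_rect (ha : 0 < a) (hb : 0 < b) : (corners (rect a b)).ncard = 2 := by
  rw [corners_rect ha hb, Set.ncard_pair (pt_fst_ne_pt_snd ha)]

lemma isMaximalCompatible_rect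
    (h₁ : ∀ x y : ℤ, ![x, y] ∈ M → |x| < a → |y| < b → x = 0 ∧ y = 0)
    (h₂ : ∀ p q : ℕ, ∃ p' < a, ∃ q' < b, ![(p : ℤ) - (p' : ℕ), (q : ℤ) - (q' : ℕ)] ∈ M) :
    IsMaximalCompatible M (rect a b) := by
  refine IsCompatible.isMaximalCompatible ⟨isLowerSet_rect, fun u hu v hv h => ?_⟩ fun u => ?_
  · have hu' := hu.1
    have hu'' := hu.2
    have hv' := hv.1
    have hv'' := hv.2
    have := h₁ _ _ (equivalent_iff_coord.1 h) (by rw [abs_lt]; omega) (by rw [abs_lt]; omega)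
    exact eq_iff_coord.2 (by omega)
  · obtain ⟨p', hp', q', hq', h⟩ := h₂ (u 0) (u 1)
    exact ⟨pt p' q', ⟨hp', hq'⟩, equivalent_iff_coord.2 h⟩

lemma IsMaximalCompatible.rect_pos (hO : IsMaximalCompatible M (rect a b)) : 0 < a ∧ 0 < b := by
  simpa [rect] using hO.zero_mem

/-- A strictly wider rectangle would contain the side vector of the narrower one, which is congruent
to 0. So the widths agree, the rectangles are nested, and maximality applies. -/
lemma rect_eq_rect_of_equivalent_fst {a' b' : ℕ} (h : IsMaximalCompatible M (rect a b))
    (h' : IsMaximalCompatible M (rect a' b')) (he : Equivalent M (pt a 0) 0)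
    (he' : Equivalent M (pt a' 0) 0) : rect a b = rect a' b' := by
  have key : ∀ {a b a' b' : ℕ}, IsMaximalCompatible M (rect a b) →
      IsMaximalCompatible M (rect a' b') → Equivalent M (pt a 0) 0 → a' ≤ a := by
    intro a b a' b' h h' he
    by_contra! hlt
    have := h'.1.2 (pt a 0) ⟨hlt, h'.rect_pos.2⟩ 0 h'.zero_mem he
    rw [eq_iff_coord] at this
    simp at this
    have := h.rect_pos
    omega
  obtain rfl : a = a' := le_antisymm (key h' h he') (key h h' he)
  rcases le_total b b' with hb | hb
  · exact h.eq_of_subset h' fun u hu => ⟨hu.1, hu.2.trans_le hb⟩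
  · exact (h'.eq_of_subset h fun u hu => ⟨hu.1, hu.2.trans_le hb⟩).symm

lemma rect_eq_rect_of_equivalent_snd {a' b' : ℕ} (h : IsMaximalCompatible M (rect a b))
    (h' : IsMaximalCompatible M (rect a' b')) (he : Equivalent M (pt 0 b) 0)
    (he' : Equivalent M (pt 0 b') 0) : rect a b = rect a' b' := by
  have key : ∀ {a b a' b' : ℕ}, IsMaximalCompatible M (rect a b) →
      IsMaximalCompatible M (rect a' b') → Equivalent M (pt 0 b) 0 → b' ≤ b := by
    intro a b a' b' h h' he
    by_contra! hlt
    have := h'.1.2 (pt 0 b) ⟨h'.rect_pos.1, hlt⟩ 0 h'.zero_mem he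
    rw [eq_iff_coord] at this
    simp at this
    have := h.rect_pos
    omega
  obtain rfl : b = b' := le_antisymm (key h' h he') (key h h' he)
  rcases le_total a a' with ha | ha
  · exact h.eq_of_subset h' fun u hu => ⟨hu.1.trans_le ha, hu.2⟩
  · exact (h'.eq_of_subset h fun u hu => ⟨hu.1.trans_le ha, hu.2⟩).symm

lemma fst_eq_of_rect_eq_rect {a' b' : ℕ} (hb : 0 < b) (hb' : 0 < b')
    (h : rect a b = rect a' b') : a = a' := by
  have key : ∀ p, p < a ↔ p < a' := fun p => by
    have : pt p 0 ∈ rect a b ↔ pt p 0 ∈ rect a' b' := by rw [h]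
    simpa [rect, hb, hb'] using this
  have h1 := key a
  have h2 := key a'
  omega

end Rectangles

/-! ### Hermite normal forms and their rectangles -/

section HermiteNormalForm

/-- A subgroup of `ℤ²` meeting both axes in positive elements has a Hermite normal form. -/
lemma exists_hermite_normal_form (N : AddSubgroup (ℤ × ℤ)) (h₀ : ∃ d : ℕ, 0 < d ∧ ((d : ℤ), 0) ∈ N)
    (h₁ : ∃ d : ℕ, 0 < d ∧ (0, (d : ℤ)) ∈ N) :
    ∃ a₁ a₂ a₃ : ℕ, 0 < a₁ ∧ a₂ < a₃ ∧
      ((a₁ : ℤ), (a₂ : ℤ)) ∈ N ∧ (0, (a₃ : ℤ)) ∈ N ∧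
      ∀ x y, (x, y) ∈ N → ∃ s t : ℤ, x = s * a₁ ∧ y = s * a₂ + t * a₃ := by
  classical
  -- `a₁` is the least positive first coordinate occurring in `N`, `a₃` the least positive element
  -- on the second axis, and `a₂` comes from reducing mod `a₃`. Nonzero remainders later contradict
  -- these minimalities.
  have h₀' : ∃ d : ℕ, 0 < d ∧ ∃ y, ((d : ℤ), y) ∈ N := by
    obtain ⟨d, hd, h⟩ := h₀
    exact ⟨d, hd, 0, h⟩
  obtain ⟨ha₁, y, hy⟩ := Nat.find_spec h₀'
  obtain ⟨ha₃, hz⟩ := Nat.find_spec h₁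
  have min₁ := fun k => Nat.find_min h₀' (m := k)
  have min₃ := fun k => Nat.find_min h₁ (m := k)
  generalize Nat.find h₀' = a₁ at *
  generalize Nat.find h₁ = a₃ at *
  have ha₁' : (0 : ℤ) < a₁ := by exact_mod_cast ha₁
  have ha₃' : (0 : ℤ) < a₃ := by exact_mod_cast ha₃
  have hnn := Int.emod_nonneg y ha₃'.ne'
  have hlt := Int.emod_lt_of_pos y ha₃'
  have hrow : ((a₁ : ℤ), y % a₃) ∈ N := by
    have := N.sub_mem hy (N.zsmul_mem hz (y / a₃))
    have e : ((a₁ : ℤ), y) - (y / a₃) • ((0 : ℤ), (a₃ : ℤ)) = ((a₁ : ℤ), y % a₃) := by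
      have := Int.emod_add_mul_ediv y a₃
      simp only [Prod.smul_mk, Prod.mk_sub_mk, smul_eq_mul, mul_zero, sub_zero, Prod.mk.injEq,
        true_and]
      linarith
    rwa [e] at this
  obtain ⟨a₂, ha₂⟩ := Int.eq_ofNat_of_zero_le hnn
  rw [ha₂] at hrow hlt
  refine ⟨a₁, a₂, a₃, ha₁, by exact_mod_cast hlt, hrow, hz, fun x z hxz => ?_⟩
  have hx : ∃ s : ℤ, x = s * a₁ := by
    refine ⟨x / a₁, ?_⟩
    have hr := Int.emod_nonneg x ha₁'.ne'
    have hr' := Int.emod_lt_of_pos x ha₁'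
    have hdm := Int.emod_add_mul_ediv x a₁
    obtain ⟨r, hr''⟩ := Int.eq_ofNat_of_zero_le hr
    rw [hr''] at hdm hr'
    rcases Nat.eq_zero_or_pos r with rfl | hpos
    · push_cast at hdm
      linarith
    · refine absurd ⟨hpos, z - (x / a₁) * a₂, ?_⟩ (min₁ r (by exact_mod_cast hr'))
      have := N.sub_mem hxz (N.zsmul_mem hrow (x / a₁))
      have e : (x, z) - (x / a₁) • ((a₁ : ℤ), (a₂ : ℤ)) = ((r : ℤ), z - (x / a₁) * a₂) := by
        simp only [Prod.smul_mk, Prod.mk_sub_mk, smul_eq_mul, Prod.mk.injEq, and_true]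
        linarith
      rwa [e] at this
  obtain ⟨s, rfl⟩ := hx
  set w := z - s * a₂ with hw
  have hwN : ((0 : ℤ), w) ∈ N := by
    have := N.sub_mem hxz (N.zsmul_mem hrow s)
    have e : (s * a₁, z) - s • ((a₁ : ℤ), (a₂ : ℤ)) = ((0 : ℤ), w) := by simp [hw]
    rwa [e] at this
  refine ⟨s, w / a₃, rfl, ?_⟩
  have hr := Int.emod_nonneg w ha₃'.ne'
  have hr' := Int.emod_lt_of_pos w ha₃'
  have hdm := Int.emod_add_mul_ediv w a₃
  obtain ⟨r, hr''⟩ := Int.eq_ofNat_of_zero_le hr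
  rw [hr''] at hdm hr'
  rcases Nat.eq_zero_or_pos r with rfl | hpos
  · push_cast at hdm
    linarith
  · refine absurd ⟨hpos, ?_⟩ (min₃ r (by exact_mod_cast hr'))
    have := N.sub_mem hwN (N.zsmul_mem hz (w / a₃))
    have e : ((0 : ℤ), w) - (w / a₃) • ((0 : ℤ), (a₃ : ℤ)) = ((0 : ℤ), (r : ℤ)) := by
      simp only [Prod.smul_mk, Prod.mk_sub_mk, smul_eq_mul, mul_zero, sub_zero, Prod.mk.injEq,
        true_and]
      linarith
    rwa [e] at this

lemma hermite_separated {a₁ a₂ a₃ s t : ℤ} (h₁ : |s * a₁| < a₁)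
    (h₃ : |s * a₂ + t * a₃| < a₃) : s * a₁ = 0 ∧ s * a₂ + t * a₃ = 0 := by
  have h1 := Int.eq_zero_of_abs_lt_dvd (Dvd.intro_left s rfl) h₁
  have hs : s = 0 := by
    rcases mul_eq_zero.1 h1 with h | h
    · exact h
    · rw [h] at h₁
      simp at h₁
  rw [hs, zero_mul, zero_add] at h₃
  rw [hs, zero_mul, zero_mul, zero_add]
  exact ⟨rfl, Int.eq_zero_of_abs_lt_dvd (Dvd.intro_left t rfl) h₃⟩

lemma hermite_reduce {a₁ a₃ : ℕ} (a₂ : ℕ) (h₁ : 0 < a₁) (h₃ : 0 < a₃) (p q : ℕ) :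
    ∃ p' < a₁, ∃ q' < a₃, ∃ s t : ℤ,
      (p : ℤ) - (p' : ℕ) = s * a₁ ∧ (q : ℤ) - (q' : ℕ) = s * a₂ + t * a₃ := by
  have h₃' : (0 : ℤ) < a₃ := by exact_mod_cast h₃
  -- The first row is used up on `p`; the second then reduces the corrected second coordinate
  -- without disturbing the first.
  set s : ℤ := (p : ℤ) / a₁ with hs
  set w : ℤ := q - s * a₂ with hw
  obtain ⟨q', hq'⟩ := Int.eq_ofNat_of_zero_le (Int.emod_nonneg w h₃'.ne')
  have hlt := Int.emod_lt_of_pos w h₃'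
  have hdm := Int.emod_add_mul_ediv w a₃
  rw [hq'] at hlt hdm
  refine ⟨p % a₁, Nat.mod_lt _ h₁, q', by exact_mod_cast hlt, s, w / a₃, ?_, ?_⟩
  · have := Int.emod_add_mul_ediv (p : ℤ) a₁
    push_cast
    rw [hs]
    linarith
  · linarith

/-- The outer `% b` matters only for `a = 0`, where it turns `b` into 0. -/
lemma exists_sub_mod_eq {a b : ℕ} (h : a < b) :
    ∃ t : ℤ, (((b - a) % b : ℕ) : ℤ) = -(a : ℤ) + t * b := by
  rcases Nat.eq_zero_or_pos a with rfl | ha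
  · exact ⟨0, by simp⟩
  · refine ⟨1, ?_⟩
    rw [Nat.mod_eq_of_lt (by omega)]
    push_cast [h.le]
    ring

lemma IsHNF.mem_iff {a₁ a₂ a₃ : ℕ} (h : IsHNF M a₁ a₂ a₃) {x y : ℤ} :
    ![x, y] ∈ M ↔ ∃ s t : ℤ, x = s * a₁ ∧ y = s * a₂ + t * a₃ := by
  rw [h.2.2, Submodule.mem_span_pair]
  simp [eq_comm]

lemma IsReverseHNF.mem_iff {b₁ b₂ b₃ : ℕ} (h : IsReverseHNF M b₁ b₂ b₃) {x y : ℤ} :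
    ![x, y] ∈ M ↔ ∃ s t : ℤ, y = s * b₂ ∧ x = s * b₁ + t * b₃ := by
  rw [h.2.2, Submodule.mem_span_pair]
  simp [eq_comm, and_comm]

lemma IsHNF.isMaximalCompatible {a₁ a₂ a₃ : ℕ} (h : IsHNF M a₁ a₂ a₃) :
    IsMaximalCompatible M (rect a₁ a₃) := by
  refine isMaximalCompatible_rect (fun x y hxy hx hy => ?_) fun p q => ?_
  · obtain ⟨s, t, rfl, rfl⟩ := h.mem_iff.1 hxy
    exact hermite_separated hx hy
  · obtain ⟨p', hp', q', hq', hst⟩ :=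
      hermite_reduce a₂ h.1 (Nat.zero_le _ |>.trans_lt h.2.1) p q
    exact ⟨p', hp', q', hq', h.mem_iff.2 hst⟩

lemma IsReverseHNF.isMaximalCompatible {b₁ b₂ b₃ : ℕ} (h : IsReverseHNF M b₁ b₂ b₃) :
    IsMaximalCompatible M (rect b₃ b₂) := by
  refine isMaximalCompatible_rect (fun x y hxy hx hy => ?_) fun p q => ?_
  · obtain ⟨s, t, rfl, rfl⟩ := h.mem_iff.1 hxy
    exact (hermite_separated hy hx).symm
  · obtain ⟨q', hq', p', hp', hst⟩ :=
      hermite_reduce b₁ h.1 (Nat.zero_le _ |>.trans_lt h.2.1) q p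
    exact ⟨p', hp', q', hq', h.mem_iff.2 hst⟩

lemma IsHNF.equivalent_snd {a₁ a₂ a₃ : ℕ} (h : IsHNF M a₁ a₂ a₃) : Equivalent M (pt 0 a₃) 0 :=
  equivalent_iff_coord.2 (h.mem_iff.2 ⟨0, 1, by simp⟩)

lemma IsReverseHNF.equivalent_fst {b₁ b₂ b₃ : ℕ} (h : IsReverseHNF M b₁ b₂ b₃) :
    Equivalent M (pt b₃ 0) 0 :=
  equivalent_iff_coord.2 (h.mem_iff.2 ⟨0, 1, by simp⟩)

lemma IsHNF.equivalent_fst_iff {a₁ a₂ a₃ : ℕ} (h : IsHNF M a₁ a₂ a₃) :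
    Equivalent M (pt a₁ 0) 0 ↔ a₂ = 0 := by
  rw [equivalent_iff_coord, h.mem_iff]
  have h1 := h.1
  have h2 := h.2.1
  constructor
  · rintro ⟨s, t, hs, ht⟩
    simp only [pt_zero_coord, pt_one_coord, Finsupp.coe_zero, Pi.zero_apply, Nat.cast_zero,
      sub_zero] at hs ht
    have hs1 : s = 1 := mul_right_cancel₀ (b := (a₁ : ℤ)) (by exact_mod_cast h1.ne') (by linarith)
    rw [hs1, one_mul] at ht
    have := Int.eq_zero_of_abs_lt_dvd (m := (a₃ : ℤ)) (x := (a₂ : ℤ)) ⟨-t, by linarith⟩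
      (by rw [Nat.abs_cast]; exact_mod_cast h2)
    exact_mod_cast this
  · rintro rfl
    exact ⟨1, 0, by simp⟩

lemma IsHNF.cornerBinomials_rect (K : Type*) [Field K] {a₁ a₂ a₃ : ℕ} (h : IsHNF M a₁ a₂ a₃) :
    cornerBinomials K M (rect a₁ a₃) = rectBasis K a₁ a₂ a₃ := by
  have h3 : 0 < a₃ := Nat.zero_le _ |>.trans_lt h.2.1
  have he : Equivalent M (pt a₁ 0) (pt 0 ((a₃ - a₂) % a₃)) := by
    obtain ⟨t, ht⟩ := exists_sub_mod_eq h.2.1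
    rw [equivalent_iff_coord, h.mem_iff]
    refine ⟨1, -t, by simp, ?_⟩
    simp only [pt_one_coord, ht]
    push_cast
    ring
  rw [cornerBinomials_pair h.isMaximalCompatible.1 (corners_rect h.1 h3)
    ⟨h.1, Nat.mod_lt _ h3⟩ h.isMaximalCompatible.zero_mem he h.equivalent_snd]
  simp only [← pt_zero_zero, mono_pt, pow_zero, one_mul, mul_one, rectBasis]

lemma IsReverseHNF.cornerBinomials_rect (K : Type*) [Field K] {b₁ b₂ b₃ : ℕ}
    (h : IsReverseHNF M b₁ b₂ b₃) :
    cornerBinomials K M (rect b₃ b₂) = reverseRectBasis K b₁ b₂ b₃ := by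
  have h3 : 0 < b₃ := Nat.zero_le _ |>.trans_lt h.2.1
  have he : Equivalent M (pt 0 b₂) (pt ((b₃ - b₁) % b₃) 0) := by
    obtain ⟨t, ht⟩ := exists_sub_mod_eq h.2.1
    rw [equivalent_iff_coord, h.mem_iff]
    refine ⟨1, -t, by simp, ?_⟩
    simp only [pt_zero_coord, ht]
    push_cast
    ring
  rw [cornerBinomials_pair h.isMaximalCompatible.1 ((corners_rect h3 h.1).trans (Set.pair_comm _ _))
    ⟨Nat.mod_lt _ h3, h.1⟩ h.isMaximalCompatible.zero_mem he h.equivalent_fst]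
  simp only [← pt_zero_zero, mono_pt, pow_zero, one_mul, mul_one, reverseRectBasis]

lemma exists_isHNF (h₀ : ∃ d : ℕ, 0 < d ∧ ![(d : ℤ), 0] ∈ M)
    (h₁ : ∃ d : ℕ, 0 < d ∧ ![0, (d : ℤ)] ∈ M) : ∃ a₁ a₂ a₃ : ℕ, IsHNF M a₁ a₂ a₃ := by
  let N : AddSubgroup (ℤ × ℤ) :=
    { carrier := {v | ![v.1, v.2] ∈ M}
      add_mem' := fun {u v} hu hv => by simpa using M.add_mem hu hv
      zero_mem' := by
        have h : ![(0 : ℤ), 0] = 0 := by ext i; fin_cases i <;> rfl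
        exact (congrArg (· ∈ M) h).mpr M.zero_mem
      neg_mem' := fun {u} hu => by simpa using M.neg_mem hu }
  obtain ⟨a₁, a₂, a₃, h1, h2, hr₁, hr₂, h⟩ := exists_hermite_normal_form N h₀ h₁
  refine ⟨a₁, a₂, a₃, h1, h2, le_antisymm (fun v hv => ?_) (Submodule.span_le.2 ?_)⟩
  · have hv' : v = ![v 0, v 1] := by ext i; fin_cases i <;> rfl
    rw [hv'] at hv
    obtain ⟨s, t, hs, ht⟩ := h _ _ hv
    rw [hv', Submodule.mem_span_pair]
    exact ⟨s, t, by simp [hs, ht]⟩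
  · rintro _ (rfl | rfl)
    exacts [hr₁, hr₂]

lemma exists_isReverseHNF (h₀ : ∃ d : ℕ, 0 < d ∧ ![(d : ℤ), 0] ∈ M)
    (h₁ : ∃ d : ℕ, 0 < d ∧ ![0, (d : ℤ)] ∈ M) : ∃ b₁ b₂ b₃ : ℕ, IsReverseHNF M b₁ b₂ b₃ := by
  -- The lattice with its two coordinates swapped.
  let N : AddSubgroup (ℤ × ℤ) :=
    { carrier := {v | ![v.2, v.1] ∈ M}
      add_mem' := fun {u v} hu hv => by simpa using M.add_mem hu hv
      zero_mem' := by
        have h : ![(0 : ℤ), 0] = 0 := by ext i; fin_cases i <;> rfl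
        exact (congrArg (· ∈ M) h).mpr M.zero_mem
      neg_mem' := fun {u} hu => by simpa using M.neg_mem hu }
  obtain ⟨b₂, b₁, b₃, h1, h2, hr₁, hr₂, h⟩ := exists_hermite_normal_form N h₁ h₀
  refine ⟨b₁, b₂, b₃, h1, h2, le_antisymm (fun v hv => ?_) (Submodule.span_le.2 ?_)⟩
  · have hv' : v = ![v 0, v 1] := by ext i; fin_cases i <;> rfl
    rw [hv'] at hv
    obtain ⟨s, t, hs, ht⟩ := h _ _ hv
    rw [hv', Submodule.mem_span_pair]
    exact ⟨s, t, by simp [hs, ht]⟩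
  · rintro _ (rfl | rfl)
    exacts [hr₁, hr₂]

end HermiteNormalForm

end Plane

/-- The quotient by a sublattice of full rank has rank 0, so it is torsion. -/
lemma exists_pos_smul_mem {n : ℕ} {M : Submodule ℤ (Fin n → ℤ)} (hM : Module.finrank ℤ M = n)
    (v : Fin n → ℤ) : ∃ d : ℕ, 0 < d ∧ (d : ℤ) • v ∈ M := by
  have h0 : Module.finrank ℤ ((Fin n → ℤ) ⧸ M) = 0 := by
    have := M.finrank_quotient_add_finrank
    rw [hM, Module.finrank_fin_fun] at this
    omega
  obtain ⟨a, ha, hav⟩ := Module.finrank_eq_zero_iff.1 h0 (Submodule.Quotient.mk v)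
  rw [← Submodule.Quotient.mk_smul, Submodule.Quotient.mk_eq_zero] at hav
  refine ⟨a.natAbs, Int.natAbs_pos.2 ha, ?_⟩
  rcases Int.natAbs_eq a with h | h
  · rwa [← h]
  · rw [← neg_eq_iff_eq_neg] at h
    rw [← h, neg_smul]
    exact M.neg_mem hav

lemma IsFrame.hermite_rect_or_inclined {M : Submodule ℤ (Fin 2 → ℤ)} {O : Set (Fin 2 →₀ ℕ)}
    {α α' β β' a₁ a₂ a₃ b₁ b₂ b₃ : ℕ} (hF : IsFrame M O α α' β β') (hO : IsMaximalCompatible M O)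
    (ha : IsHNF M a₁ a₂ a₃) (hb : IsReverseHNF M b₁ b₂ b₃) :
    (O = rect a₁ a₃ ∨ O = rect b₃ b₂) ∨
      ∃ γ₁ γ₂, 0 < γ₁ ∧ 0 < γ₂ ∧ Equivalent M (pt γ₁ γ₂) 0 ∧
        corners O = {pt α 0, pt 0 β, pt γ₁ γ₂} := by
  rcases hF.rect_or_inclined hO.1 with ⟨rfl, rfl | rfl⟩ | h
  · exact Or.inl (Or.inr (rect_eq_rect_of_equivalent_fst hO hb.isMaximalCompatible
      (pt_zero_zero ▸ hF.equiv_fst) hb.equivalent_fst))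
  · exact Or.inl (Or.inl (rect_eq_rect_of_equivalent_snd hO ha.isMaximalCompatible
      (pt_zero_zero ▸ hF.equiv_snd) ha.equivalent_snd))
  · exact Or.inr h

lemma ncard_inclined_corners {α β γ₁ γ₂ : ℕ} (hα : 0 < α) (h₁ : 0 < γ₁) (h₂ : 0 < γ₂) :
    ({pt α 0, pt 0 β, pt γ₁ γ₂} : Set (Fin 2 →₀ ℕ)).ncard = 3 := by
  refine Set.ncard_eq_three.2 ⟨_, _, _, pt_fst_ne_pt_snd hα, ?_, ?_, rfl⟩
  · rw [Ne, eq_iff_coord]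
    simp
    omega
  · rw [Ne, eq_iff_coord]
    simp
    omega

end LatticeBorder

open LatticeBorder
theorem mainTheorem5 {K : Type*} [Field K] (M : Submodule ℤ (Fin 2 → ℤ))
    (hM : Module.finrank ℤ M = 2) :
    -- maximal compatible order ideals are the sets of standard exponents of the term orders
    (∀ O : Set (Fin 2 →₀ ℕ), LatticeBorder.IsMaximalCompatible M O ↔
      ∃ m : MonomialOrder.{0, 0} (Fin 2),
        O = LatticeBorder.standardExponents m (LatticeBorder.latticeIdeal K M)) ∧
    -- the reduced Groebner basis of each term order is read off the corners
    (∀ (m : MonomialOrder.{0, 0} (Fin 2)) (G : Set (MvPolynomial (Fin 2) K)),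
      LatticeBorder.IsReducedGroebnerBasis m (LatticeBorder.latticeIdeal K M) G ↔
        G = LatticeBorder.cornerBinomials K M
          (LatticeBorder.standardExponents m (LatticeBorder.latticeIdeal K M))) ∧
    -- distinct maximal compatible order ideals give distinct reduced Groebner bases
    Set.InjOn (LatticeBorder.cornerBinomials K M) {O | LatticeBorder.IsMaximalCompatible M O} ∧
    -- every border basis comes from a reduced Groebner basis
    (∀ (O : Set (Fin 2 →₀ ℕ)) (B : Set (MvPolynomial (Fin 2) K)),
      LatticeBorder.IsBorderBasis (LatticeBorder.latticeIdeal K M) O B →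
        ∃ m : MonomialOrder.{0, 0} (Fin 2),
          O = LatticeBorder.standardExponents m (LatticeBorder.latticeIdeal K M) ∧
          LatticeBorder.IsReducedGroebnerBasis m (LatticeBorder.latticeIdeal K M)
            (LatticeBorder.cornerPart O B)) ∧
    -- and conversely
    (∀ (m : MonomialOrder.{0, 0} (Fin 2)) (G : Set (MvPolynomial (Fin 2) K)),
      LatticeBorder.IsReducedGroebnerBasis m (LatticeBorder.latticeIdeal K M) G →
        ∃ B : Set (MvPolynomial (Fin 2) K),
          LatticeBorder.IsBorderBasis (LatticeBorder.latticeIdeal K M)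
            (LatticeBorder.standardExponents m (LatticeBorder.latticeIdeal K M)) B ∧
          G = LatticeBorder.cornerPart
            (LatticeBorder.standardExponents m (LatticeBorder.latticeIdeal K M)) B) ∧
    -- the two normal forms exist
    (∃ a₁ a₂ a₃ : ℕ, LatticeBorder.IsHNF M a₁ a₂ a₃) ∧
    (∃ b₁ b₂ b₃ : ℕ, LatticeBorder.IsReverseHNF M b₁ b₂ b₃) ∧
    (∀ a₁ a₂ a₃ b₁ b₂ b₃ : ℕ,
      LatticeBorder.IsHNF M a₁ a₂ a₃ → LatticeBorder.IsReverseHNF M b₁ b₂ b₃ →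
      -- the two rectangles and their Groebner bases
      LatticeBorder.IsMaximalCompatible M (LatticeBorder.rect a₁ a₃) ∧
      LatticeBorder.cornerBinomials K M (LatticeBorder.rect a₁ a₃) =
        LatticeBorder.rectBasis K a₁ a₂ a₃ ∧
      LatticeBorder.IsMaximalCompatible M (LatticeBorder.rect b₃ b₂) ∧
      LatticeBorder.cornerBinomials K M (LatticeBorder.rect b₃ b₂) =
        LatticeBorder.reverseRectBasis K b₁ b₂ b₃ ∧
      -- the reduced Groebner bases with exactly two elements
      (∀ G : Set (MvPolynomial (Fin 2) K),
        ((∃ m : MonomialOrder.{0, 0} (Fin 2),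
            LatticeBorder.IsReducedGroebnerBasis m (LatticeBorder.latticeIdeal K M) G) ∧
          G.ncard = 2) ↔
        (G = LatticeBorder.rectBasis K a₁ a₂ a₃ ∨
          G = LatticeBorder.reverseRectBasis K b₁ b₂ b₃)) ∧
      (LatticeBorder.rectBasis K a₁ a₂ a₃ = LatticeBorder.reverseRectBasis K b₁ b₂ b₃ ↔ a₂ = 0) ∧
      -- all the others have exactly three elements
      (∀ (m : MonomialOrder.{0, 0} (Fin 2)) (G : Set (MvPolynomial (Fin 2) K)),
        LatticeBorder.IsReducedGroebnerBasis m (LatticeBorder.latticeIdeal K M) G →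
        G ≠ LatticeBorder.rectBasis K a₁ a₂ a₃ →
        G ≠ LatticeBorder.reverseRectBasis K b₁ b₂ b₃ →
        G.ncard = 3 ∧
        ∃ (O : Set (Fin 2 →₀ ℕ)) (α α' β β' γ₁ γ₂ : ℕ),
          O = LatticeBorder.standardExponents m (LatticeBorder.latticeIdeal K M) ∧
          LatticeBorder.IsMaximalCompatible M O ∧
          LatticeBorder.corners O =
            {LatticeBorder.pt α 0, LatticeBorder.pt 0 β, LatticeBorder.pt γ₁ γ₂} ∧
          LatticeBorder.pt 0 α' ∈ O ∧
          LatticeBorder.Equivalent M (LatticeBorder.pt α 0) (LatticeBorder.pt 0 α') ∧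
          LatticeBorder.pt β' 0 ∈ O ∧
          LatticeBorder.Equivalent M (LatticeBorder.pt 0 β) (LatticeBorder.pt β' 0) ∧
          G = {MvPolynomial.X 0 ^ α - MvPolynomial.X 1 ^ α',
            MvPolynomial.X 1 ^ β - MvPolynomial.X 0 ^ β',
            MvPolynomial.X 0 ^ γ₁ * MvPolynomial.X 1 ^ γ₂ - 1})) := by
  have axis₀ : ∃ d : ℕ, 0 < d ∧ ![(d : ℤ), 0] ∈ M := by
    simpa using exists_pos_smul_mem hM ![1, 0]
  have axis₁ : ∃ d : ℕ, 0 < d ∧ ![0, (d : ℤ)] ∈ M := by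
    simpa using exists_pos_smul_mem hM ![0, 1]
  have frame : ∀ O, IsMaximalCompatible M O → ∃ α α' β β', IsFrame M O α α' β β' :=
    fun O hO => hO.exists_isFrame axis₀ axis₁
  have termOrder : ∀ O, IsMaximalCompatible M O →
      ∃ m : MonomialOrder.{0, 0} (Fin 2), O = standardExponents m (latticeIdeal K M) := by
    intro O hO
    obtain ⟨α, α', β, β', hF⟩ := frame O hO
    exact hF.exists_eq_standardExponents K hO
  have hinj : Set.InjOn (cornerBinomials K M) {O | IsMaximalCompatible M O} := by
    intro O hO O' hO' h
    obtain ⟨α, α', β, β', hF⟩ := frame O hO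
    obtain ⟨γ, γ', δ, δ', hF'⟩ := frame O' hO'
    exact eq_of_cornerBinomials_eq hO hO' hF hF' h
  refine ⟨fun O => ⟨termOrder O, ?_⟩, fun m G => isReducedGroebnerBasis_iff, hinj, ?_, ?_,
    exists_isHNF axis₀ axis₁, exists_isReverseHNF axis₀ axis₁, ?_⟩
  · rintro ⟨m, rfl⟩
    exact isMaximalCompatible_standardExponents m
  · intro O B hB
    obtain ⟨m, hm⟩ := termOrder O hB.isMaximalCompatible
    refine ⟨m, hm, ?_⟩
    rw [isReducedGroebnerBasis_iff, hB.cornerPart_eq, hm]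
  · intro m G hG
    obtain ⟨B, hB⟩ := exists_isBorderBasis (K := K) (M := M)
      (isCompatible_standardExponents (K := K) (m := m)) exists_mem_standardExponents
    exact ⟨B, hB, by rw [hB.cornerPart_eq, isReducedGroebnerBasis_iff.1 hG]⟩
  intro a₁ a₂ a₃ b₁ b₂ b₃ ha hb
  have hra := ha.isMaximalCompatible
  have hrb := hb.isMaximalCompatible
  have hba := ha.cornerBinomials_rect K
  have hbb := hb.cornerBinomials_rect K
  have ncard : ∀ O, IsMaximalCompatible M O →
      (cornerBinomials K M O).ncard = (corners O).ncard :=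
    fun O hO => ncard_cornerBinomials hO.1 fun c hc => hO.exists_rep_corner hc
  have two : ∀ a b, IsMaximalCompatible M (rect a b) →
      (∃ m : MonomialOrder.{0, 0} (Fin 2), IsReducedGroebnerBasis m (latticeIdeal K M)
        (cornerBinomials K M (rect a b))) ∧ (cornerBinomials K M (rect a b)).ncard = 2 := by
    intro a b h
    obtain ⟨m, hm⟩ := termOrder _ h
    refine ⟨⟨m, isReducedGroebnerBasis_iff.2 (by rw [hm])⟩, ?_⟩
    rw [ncard _ h, ncard_corners_rect h.rect_pos.1 h.rect_pos.2]
  refine ⟨hra, hba, hrb, hbb, fun G => ⟨?_, ?_⟩, ⟨fun h => ?_, fun h => ?_⟩, ?_⟩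
  · rintro ⟨⟨m, hG⟩, hcard⟩
    have hO := isMaximalCompatible_standardExponents (K := K) (M := M) m
    rw [isReducedGroebnerBasis_iff] at hG
    obtain ⟨α, α', β, β', hF⟩ := frame _ hO
    rcases hF.hermite_rect_or_inclined hO ha hb with (h | h) | ⟨γ₁, γ₂, h₁, h₂, -, hc⟩
    · exact Or.inl (by rw [hG, h, hba])
    · exact Or.inr (by rw [hG, h, hbb])
    · rw [hG, ncard _ hO, hc,
        ncard_inclined_corners ((Nat.zero_le _).trans_lt (hF.lt_fst hO.1.1)) h₁ h₂] at hcard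
      omega
  · rintro (rfl | rfl)
    · exact hba ▸ two _ _ hra
    · exact hbb ▸ two _ _ hrb
  · rw [← hba, ← hbb] at h
    -- Equal bases give equal rectangles, so `a₁ = b₃` and `(a₁, 0)` lies in `M`, which happens only
    -- for `a₂ = 0`.
    have hfst := fst_eq_of_rect_eq_rect hra.rect_pos.2 hrb.rect_pos.2 (hinj hra hrb h)
    exact ha.equivalent_fst_iff.1 (hfst ▸ hb.equivalent_fst)
  · rw [← hba, ← hbb, rect_eq_rect_of_equivalent_fst hra hrb (ha.equivalent_fst_iff.2 h)
      hb.equivalent_fst]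
  · intro m G hG hGa hGb
    have hO := isMaximalCompatible_standardExponents (K := K) (M := M) m
    rw [isReducedGroebnerBasis_iff] at hG
    obtain ⟨α, α', β, β', hF⟩ := frame _ hO
    rcases hF.hermite_rect_or_inclined hO ha hb with (h | h) | ⟨γ₁, γ₂, h₁, h₂, he, hc⟩
    · exact absurd (by rw [hG, h, hba]) hGa
    · exact absurd (by rw [hG, h, hbb]) hGb
    · refine ⟨?_, _, α, α', β, β', γ₁, γ₂, rfl, hO, hc, hF.mem_fst, hF.equiv_fst, hF.mem_snd,
        hF.equiv_snd, ?_⟩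
      · rw [hG, ncard _ hO, hc,
          ncard_inclined_corners ((Nat.zero_le _).trans_lt (hF.lt_fst hO.1.1)) h₁ h₂]
      · rw [hG, cornerBinomials_triple hO.1 hc hF.mem_fst hF.mem_snd hO.zero_mem hF.equiv_fst
          hF.equiv_snd he]
        simp only [← pt_zero_zero, mono_pt, pow_zero, one_mul, mul_one]
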